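/- Let $X(r,\theta)=(r\cos\theta,r\sin\theta)$, let $\theta_0\in\mathbb R$, $r_*>0$, and let $r_1,r_2:[\theta_0,\infty)\to(0,\infty)$ be continuous with $r_2(\theta+2\pi)<r_1(\theta)<r_2(\theta)$ for all $\theta\ge\theta_0$ and $\lim_{\theta\to\infty}r_1(\theta)=\lim_{\theta\to\infty}r_2(\theta)=r_*$. Let $\bar R$ be a number with $r_2\le\bar R$ on $[\theta_0,\infty)$ (such a number exists). Put $$U=\{X(r,\theta):\theta>\theta_0,\ r_1(\theta)<r<r_2(\theta)\},\qquad \widetilde U=\{X(r,\theta):\theta\ge\theta_0,\ r_1(\theta)\le r\le r_2(\theta)\},$$ $$\mathcal S_\theta=\{X(r,\theta):r_1(\theta)\le r\le r_2(\theta)\},\qquad \gamma=\{X(r_i(\theta),\theta):\theta\ge\theta_0,\ i=1,2\}.$$ Let $A=(a_{ij})$ be a function from $U$ to the symmetric real $2\times2$ matrices and $b:U\to\mathbb R^2$, and let $c_0>0$, $M_1>0$, $M_2\ge0$ be such that $\xi^{\rm T}A(x)\xi\ge c_0|\xi|^2$, $\operatorname{Tr}A(x)\le M_1$ and $|b(x)|\le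 M_2$ for all $x\in U$, $\xi\in\mathbb R^2$. Let $Lu=-\sum_{i,j}a_{ij}\,\partial^2u/\partial x_i\partial x_j+b\cdot\nabla u$. Write $\operatorname{osc}_E u=\sup_E u-\inf_E u$. Then there are constants $C_*>0$ and $\nu>0$, depending only on $r_*,\bar R,c_0,M_1,M_2$, such that the following holds for every $u\in C^2(U)\cap C(\widetilde U)$ with $Lu=0$ in $U$ which is bounded on $\gamma$ and is below exponential growth in $\widetilde U$, that is, $\lim_{\theta\to\infty}e^{-\varepsilon\theta}\sup_{\mathcal S_\theta}|u|=0$ for every $\varepsilon>0$. The function $u$ is bounded on $\widetilde U$, $$\operatorname*{osc}_{\widetilde U}u\le\operatorname*{osc}_{\mathcal S_{\theta_0}\cup\gamma}u,$$ $$\operatorname*{osc}_{\mathcal S_\theta}u\le\Big(\operatorname*{osc}_{\gamma}u\Big)\big(1-C_*e^{-\nu(\theta-\theta_0)}\big)+C_*\Big(\operatorname*{osc}_{\mathcal S_{\theta_0}\cup\gamma}u\Big)e^{-\nu(\theta-\theta_0)}\quad\text{for all }\theta\ge\theta_0,$$ and $$\limsup_{\theta\to\infty}\Big(\operatorname*{osc}_{\mathcal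 S_\theta}u\Big)\le\limsup_{\theta\to\infty}M_\gamma(\theta)-\liminf_{\theta\to\infty}m_\gamma(\theta),$$ where $M_\gamma(\theta)=\max_{i=1,2}u(X(r_i(\theta),\theta))$ and $m_\gamma(\theta)=\min_{i=1,2}u(X(r_i(\theta),\theta))$. -/

import Mathlib

open Set Filter Topology

noncomputable section

namespace Spiral

/-- The Euclidean plane. -/
abbrev Plane : Type := EuclideanSpace ℝ (Fin 2)

/-- Polar coordinates `X(r, θ) = (r cos θ, r sin θ)`. -/
def polar (r θ : ℝ) : Plane := !₂[r * Real.cos θ, r * Real.sin θ]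

/-- The standing assumptions on the radii `r₁, r₂`: they are positive and continuous on `[θ₀, ∞)`,
the strip between them does not meet itself when it winds around the origin, and both radii
converge to `rs > 0` as `θ → ∞`. -/
structure IsSpiral (θ₀ : ℝ) (r₁ r₂ : ℝ → ℝ) (rs : ℝ) : Prop where
  rs_pos : 0 < rs
  cont₁ : ContinuousOn r₁ (Ici θ₀)
  cont₂ : ContinuousOn r₂ (Ici θ₀)
  pos₁ : ∀ θ, θ₀ ≤ θ → 0 < r₁ θ
  pos₂ : ∀ θ, θ₀ ≤ θ → 0 < r₂ θ
  turn : ∀ θ, θ₀ ≤ θ → r₂ (θ + 2 * Real.pi) < r₁ θ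
  lt : ∀ θ, θ₀ ≤ θ → r₁ θ < r₂ θ
  lim₁ : Tendsto r₁ atTop (𝓝 rs)
  lim₂ : Tendsto r₂ atTop (𝓝 rs)

/-- The open domain `U`. -/
def dom (θ₀ : ℝ) (r₁ r₂ : ℝ → ℝ) : Set Plane :=
  {x | ∃ r θ : ℝ, θ₀ < θ ∧ r₁ θ < r ∧ r < r₂ θ ∧ x = polar r θ}

/-- The set `Ũ`: the domain together with its lateral boundary and its initial cross-section
(but without the limit circle). -/
def domTilde (θ₀ : ℝ) (r₁ r₂ : ℝ → ℝ) : Set Plane :=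
  {x | ∃ r θ : ℝ, θ₀ ≤ θ ∧ r₁ θ ≤ r ∧ r ≤ r₂ θ ∧ x = polar r θ}

/-- The boundary curve `{X(ρ(θ), θ) : θ ≥ θ₀}`. -/
def curve (θ₀ : ℝ) (ρ : ℝ → ℝ) : Set Plane :=
  {x | ∃ θ : ℝ, θ₀ ≤ θ ∧ x = polar (ρ θ) θ}

/-- The lateral boundary `γ = γ₁ ∪ γ₂`. -/
def lateral (θ₀ : ℝ) (r₁ r₂ : ℝ → ℝ) : Set Plane := curve θ₀ r₁ ∪ curve θ₀ r₂

/-- The cross-section `S_θ`. -/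
def crossSection (r₁ r₂ : ℝ → ℝ) (θ : ℝ) : Set Plane :=
  {x | ∃ r : ℝ, r₁ θ ≤ r ∧ r ≤ r₂ θ ∧ x = polar r θ}

/-- The partial derivative `∂u/∂xᵢ`. -/
def partialD (i : Fin 2) (u : Plane → ℝ) (x : Plane) : ℝ :=
  fderiv ℝ u x (EuclideanSpace.single i 1)

/-- The operator `L u = - ∑ᵢⱼ aᵢⱼ ∂²u/∂xᵢ∂xⱼ + b · ∇u`. -/
def ellipticOp (A : Plane → Matrix (Fin 2) (Fin 2) ℝ) (b : Plane → Plane) (u : Plane → ℝ)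
    (x : Plane) : ℝ :=
  -(∑ i, ∑ j, A x i j * partialD i (partialD j u) x) + ∑ i, b x i * partialD i u x

/-- On `Ω` the matrices `A x` are symmetric, `ξᵀ A(x) ξ ≥ c₀ |ξ|²` and `Tr A(x) ≤ M₁`. -/
structure IsElliptic (Ω : Set Plane) (A : Plane → Matrix (Fin 2) (Fin 2) ℝ) (c₀ M₁ : ℝ) :
    Prop where
  symm : ∀ x ∈ Ω, (A x).IsSymm
  lower : ∀ x ∈ Ω, ∀ ξ : Plane, c₀ * ‖ξ‖ ^ 2 ≤ ∑ i, ∑ j, ξ i * A x i j * ξ j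
  trace_le : ∀ x ∈ Ω, (A x).trace ≤ M₁

/-- `u` is below exponential growth in `Ũ`: for each `ε > 0`,
`e^{-εθ} sup_{S_θ} |u| → 0` as `θ → ∞` (note that `S_θ ∩ Ũ = S_θ` for `θ ≥ θ₀`). -/
def BelowExpGrowth (r₁ r₂ : ℝ → ℝ) (u : Plane → ℝ) : Prop :=
  ∀ ε : ℝ, 0 < ε →
    Tendsto (fun θ : ℝ => Real.exp (-ε * θ) * sSup ((fun x => |u x|) '' crossSection r₁ r₂ θ))
      atTop (𝓝 0)

/-- The oscillation `sup_E u - inf_E u` (meaningful when `E` is nonempty and `u` is bounded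
on `E`). -/
def osc (u : Plane → ℝ) (E : Set Plane) : ℝ := sSup (u '' E) - sInf (u '' E)

/-- `M_γ(θ)`, the larger of the two boundary values of `u` at the angle `θ`. -/
def bdryMax (r₁ r₂ : ℝ → ℝ) (u : Plane → ℝ) (θ : ℝ) : ℝ :=
  max (u (polar (r₁ θ) θ)) (u (polar (r₂ θ) θ))

/-- `m_γ(θ)`, the smaller of the two boundary values of `u` at the angle `θ`. -/
def bdryMin (r₁ r₂ : ℝ → ℝ) (u : Plane → ℝ) (θ : ℝ) : ℝ :=
  min (u (polar (r₁ θ) θ)) (u (polar (r₂ θ) θ))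

end Spiral

end

noncomputable section

namespace Spiral

/-! In the variables `(r, θ)` the domain is a half-infinite strip of bounded width, and the theorem
is a Phragmén–Lindelöf argument there. The barrier is `w = h(θ) φ(|x|²)` with `φ(q) = 2 e^{αR²} -
e^{αq}`. For `α` large, the radial second derivatives beat the drift, because `|x| ≥ rs`
(`IsSpiral.rs_le`, a consequence of the winding condition). If moreover `|h'|, |h''| ≤ ν h` with `ν`
small, the angular terms cannot destroy the sign and `L w > 0` (`exists_barrier_constants`). Hence
`h` may combine a decaying `e^{-νθ}` with a growing `e^{νθ}`.

With `h = κ e^{-αR²} e^{-ν(θ-T)} + ε e^{νθ}`, the maximum of `u - w` over a truncated strip is not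
interior (`not_interior_max`). On the edges `u - w ≤ P`: laterally since `w ≥ 0`, at the start since
`w ≥ κ`, at the far end since `ε e^{νθ}` outgrows `u`. Letting `ε → 0` gives `u ≤ P + 2κ
e^{-ν(θ-T)}` (`exists_decay_rate`); the 2 is the ratio of the bounds on `φ`.

This bound is applied to `u` and `-u` in three ways: `κ = 0` gives boundedness and the global
oscillation estimate, `κ` equal to the gap between the two boundary suprema gives the exponential
estimate, and restarting at a late angle gives the `limsup` estimate. -/

/-! ### Choice of the barrier constants -/

lemma abs_two_mul_le_sq_add_sq (x y : ℝ) : |2 * x * y| ≤ x ^ 2 + y ^ 2 := by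
  rw [abs_le]
  constructor <;> nlinarith [sq_nonneg (x + y), sq_nonneg (x - y)]

lemma abs_mul_le_sq_add_sq (x y : ℝ) : |x * y| ≤ x ^ 2 + y ^ 2 := by
  rw [abs_le]
  constructor <;> nlinarith [sq_nonneg (x + y), sq_nonneg (x - y)]

lemma abs_sq_sub_sq_le (x y : ℝ) : |x ^ 2 - y ^ 2| ≤ x ^ 2 + y ^ 2 := by
  rw [abs_le]
  constructor <;> nlinarith [sq_nonneg x, sq_nonneg y]

lemma mul_add_mul_le_of_sq {p q x y M r : ℝ} (hM : 0 ≤ M) (hr : 0 ≤ r) (h : p ^ 2 + q ^ 2 ≤ M ^ 2)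
    (hxy : x ^ 2 + y ^ 2 = r) : p * x + q * y ≤ M * √r := by
  apply le_of_sq_le_sq _ (by positivity)
  rw [mul_pow, Real.sq_sqrt hr, ← hxy]
  have := mul_le_mul_of_nonneg_right h (show 0 ≤ x ^ 2 + y ^ 2 by positivity)
  nlinarith [sq_nonneg (p * y - q * x)]

set_option maxHeartbeats 1000000 in
/-- Along the barrier `h(θ) (2 e^{αR²} - e^{α|x|²})`, whose angular factor varies slowly, the
elliptic operator is positive. The quantities `t₀, t₁` and `d₀, d₁` stand for the first and second
derivatives of the angle. -/
lemma exists_barrier_constants (rs R c₀ M₁ M₂ : ℝ) (hrs : 0 < rs) (hc₀ : 0 < c₀) (hM₁ : 0 < M₁)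
    (hM₂ : 0 ≤ M₂) :
    ∃ α ν : ℝ, 0 < α ∧ 0 < ν ∧ ν ≤ 1 ∧
      ∀ a b d β₀ β₁ x y h h₁ h₂ t₀ t₁ d₀ d₁ E φ : ℝ,
      (∀ ξ η : ℝ, c₀ * (ξ ^ 2 + η ^ 2) ≤ a * ξ ^ 2 + 2 * b * ξ * η + d * η ^ 2) →
      a + d ≤ M₁ → β₀ ^ 2 + β₁ ^ 2 ≤ M₂ ^ 2 → rs ^ 2 ≤ x ^ 2 + y ^ 2 → x ^ 2 + y ^ 2 ≤ R ^ 2 →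
      0 < h → |h₁| ≤ ν * h → |h₂| ≤ ν * h →
      t₀ = -y / (x ^ 2 + y ^ 2) → t₁ = x / (x ^ 2 + y ^ 2) →
      d₀ = 2 * x * y / (x ^ 2 + y ^ 2) ^ 2 → d₁ = (y ^ 2 - x ^ 2) / (x ^ 2 + y ^ 2) ^ 2 →
      E = Real.exp (α * (x ^ 2 + y ^ 2)) → φ = 2 * Real.exp (α * R ^ 2) - E →
      0 < -(a * (h₂ * t₀ ^ 2 * φ - 4 * h₁ * t₀ * x * (α * E) + h₁ * φ * d₀
              - h * (4 * x ^ 2 * (α ^ 2 * E) + 2 * (α * E)))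
            + 2 * b * (h₂ * t₀ * t₁ * φ - 2 * h₁ * (α * E) * (t₀ * y + t₁ * x) + h₁ * φ * d₁
              - h * (4 * x * y * (α ^ 2 * E)))
            + d * (h₂ * t₁ ^ 2 * φ - 4 * h₁ * t₁ * y * (α * E) - h₁ * φ * d₀
              - h * (4 * y ^ 2 * (α ^ 2 * E) + 2 * (α * E))))
          + (β₀ * (h₁ * t₀ * φ - h * (2 * x * (α * E)))
            + β₁ * (h₁ * t₁ * φ - h * (2 * y * (α * E)))) := by
  -- Chosen so that `2 α c₀ rs ≥ M₂`, which lets the radial second-order term absorb the drift; the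
  -- `+ 1` keeps `α > 0` when `M₂ = 0`.
  set α : ℝ := (M₂ + 1) / (2 * c₀ * rs) with hα
  have hα0 : 0 < α := by positivity
  set K : ℝ := 2 * Real.exp (α * R ^ 2) with hK
  have hK0 : 0 < K := by positivity
  -- All terms containing a derivative of `h` add up to at most `ν G h`; `ν` is chosen to make this
  -- at most half of the radial gain `4 α c₀ h`.
  set G : ℝ := K * (3 * M₁ / rs ^ 2) + 4 * α * K * (3 * M₁) + K * (3 * M₁ / rs ^ 2)
    + K * (2 * M₂ / rs) with hG
  have hG0 : 0 < G := by positivity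
  set ν : ℝ := min 1 (2 * α * c₀ / G) with hν
  have hν0 : 0 < ν := lt_min one_pos (by positivity)
  have hνG : ν * G ≤ 2 * α * c₀ := by
    have : ν ≤ 2 * α * c₀ / G := min_le_right _ _
    rwa [le_div_iff₀ hG0] at this
  refine ⟨α, ν, hα0, hν0, min_le_left _ _, ?_⟩
  intro a b d β₀ β₁ x y h h₁ h₂ t₀ t₁ d₀ d₁ E φ hA htr hβ hlow hup hh hh₁ hh₂ ht₀ ht₁ hd₀ hd₁ hE hφ
  set q : ℝ := x ^ 2 + y ^ 2 with hq
  have hq0 : 0 < q := lt_of_lt_of_le (by positivity) hlow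
  have hE1 : 1 ≤ E := by rw [hE]; exact Real.one_le_exp (by positivity)
  have hEm : E ≤ K / 2 := by
    rw [hE, hK]
    have : Real.exp (α * q) ≤ Real.exp (α * R ^ 2) :=
      Real.exp_le_exp.2 (mul_le_mul_of_nonneg_left hup hα0.le)
    linarith
  have hφ0 : 0 ≤ φ := by rw [hφ]; linarith
  have hφK : |φ| ≤ K := by rw [abs_of_nonneg hφ0, hφ]; linarith
  have ha0 : c₀ ≤ a := by have := hA 1 0; norm_num at this; linarith
  have hd0 : c₀ ≤ d := by have := hA 0 1; norm_num at this; linarith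
  have haM : |a| ≤ M₁ := by rw [abs_of_pos (by linarith)]; linarith
  have hdM : |d| ≤ M₁ := by rw [abs_of_pos (by linarith)]; linarith
  -- Testing ellipticity on `(1, ±1)` bounds the off-diagonal entry by the trace.
  have hbM : |2 * b| ≤ M₁ := by
    have h1 := hA 1 1; have h2 := hA 1 (-1); norm_num at h1 h2
    rw [abs_le]; constructor <;> linarith
  have hx2 : x ^ 2 ≤ q := by rw [hq]; linarith [sq_nonneg x, sq_nonneg y]
  have hy2 : y ^ 2 ≤ q := by rw [hq]; linarith [sq_nonneg x, sq_nonneg y]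
  have hbd : ∀ z : ℝ, z ^ 2 ≤ q → |z / q| ≤ 1 / rs := by
    intro z hz
    apply abs_le_of_sq_le_sq _ (by positivity)
    rw [div_pow, div_pow, one_pow]
    calc z ^ 2 / q ^ 2 ≤ q / q ^ 2 := by gcongr
      _ = 1 / q := by field_simp
      _ ≤ 1 / rs ^ 2 := by gcongr
  have ht₀b : |t₀| ≤ 1 / rs := by rw [ht₀]; exact hbd _ (by simpa using hy2)
  have ht₁b : |t₁| ≤ 1 / rs := by rw [ht₁]; exact hbd _ hx2
  have hdb : ∀ z : ℝ, |z| ≤ q → |z / q ^ 2| ≤ 1 / rs ^ 2 := by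
    intro z hz
    rw [abs_div, abs_of_pos (show 0 < q ^ 2 by positivity)]
    calc |z| / q ^ 2 ≤ q / q ^ 2 := by gcongr
      _ = 1 / q := by field_simp
      _ ≤ 1 / rs ^ 2 := by gcongr
  have hd₀b : |d₀| ≤ 1 / rs ^ 2 := by
    rw [hd₀]; exact hdb _ (abs_two_mul_le_sq_add_sq x y)
  have hd₁b : |d₁| ≤ 1 / rs ^ 2 := by
    rw [hd₁]; apply hdb; rw [abs_sub_comm]; exact abs_sq_sub_sq_le x y
  have hone : ∀ z : ℝ, |z| ≤ q → |z / q| ≤ 1 := by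
    intro z hz
    rw [abs_div, abs_of_pos hq0]; exact (div_le_one hq0).2 hz
  have e1 : |t₀ * x| ≤ 1 := by
    rw [ht₀, div_mul_eq_mul_div]; apply hone
    rw [neg_mul, abs_neg, mul_comm]; exact abs_mul_le_sq_add_sq x y
  have e2 : |t₁ * y| ≤ 1 := by
    rw [ht₁, div_mul_eq_mul_div]; exact hone _ (abs_mul_le_sq_add_sq x y)
  have e3 : |(t₀ * y + t₁ * x) / 2| ≤ 1 := by
    rw [ht₀, ht₁, show (-y / q * y + x / q * x) / 2 = ((x ^ 2 - y ^ 2) / 2) / q by ring]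
    apply hone; rw [abs_div, abs_two]; linarith [abs_sq_sub_sq_le x y]
  clear hx2 hy2 hbd hdb hone
  have combo : ∀ p₁ p₂ p₃ B : ℝ, |p₁| ≤ B → |p₂| ≤ B → |p₃| ≤ B →
      |a * p₁ + 2 * b * p₂ + d * p₃| ≤ 3 * M₁ * B := by
    intro p₁ p₂ p₃ B h1 h2 h3
    have k : ∀ s p : ℝ, |s| ≤ M₁ → |p| ≤ B → |s * p| ≤ M₁ * B := fun s p hs hp => by
      rw [abs_mul]; exact mul_le_mul hs hp (abs_nonneg _) hM₁.le
    have := abs_add_three (a * p₁) (2 * b * p₂) (d * p₃)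
    linarith [k a p₁ haM h1, k (2 * b) p₂ hbM h2, k d p₃ hdM h3]
  have hsq : ∀ s t : ℝ, |s| ≤ 1 / rs → |t| ≤ 1 / rs → |s * t| ≤ 1 / rs ^ 2 := by
    intro s t hs ht
    rw [abs_mul, show 1 / rs ^ 2 = 1 / rs * (1 / rs) by ring]
    exact mul_le_mul hs ht (abs_nonneg _) (by positivity)
  have s1 := combo _ _ _ _ (hsq _ _ ht₀b ht₀b) (hsq _ _ ht₀b ht₁b) (hsq _ _ ht₁b ht₁b)
  have s2 := combo _ _ _ _ e1 e3 e2
  have s3 := combo d₀ d₁ (-d₀) _ hd₀b hd₁b (by rwa [abs_neg])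
  have hβ₀ : |β₀| ≤ M₂ := abs_le_of_sq_le_sq (by linarith [sq_nonneg β₀, sq_nonneg β₁]) hM₂
  have hβ₁ : |β₁| ≤ M₂ := abs_le_of_sq_le_sq (by linarith [sq_nonneg β₀, sq_nonneg β₁]) hM₂
  have s4 : |β₀ * t₀ + β₁ * t₁| ≤ 2 * M₂ / rs := by
    have k : ∀ s p : ℝ, |s| ≤ M₂ → |p| ≤ 1 / rs → |s * p| ≤ M₂ * (1 / rs) := fun s p hs hp => by
      rw [abs_mul]; exact mul_le_mul hs hp (abs_nonneg _) hM₂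
    have := abs_add_le (β₀ * t₀) (β₁ * t₁)
    have e : 2 * M₂ / rs = M₂ * (1 / rs) + M₂ * (1 / rs) := by ring
    linarith [k _ _ hβ₀ ht₀b, k _ _ hβ₁ ht₁b]
  have mul3 : ∀ p s t P S T : ℝ, |p| ≤ P → |s| ≤ S → |t| ≤ T → |p * s * t| ≤ P * S * T := by
    intro p s t P S T hp hs ht
    have hP := (abs_nonneg _).trans hp
    have hS := (abs_nonneg _).trans hs
    rw [abs_mul, abs_mul]
    exact mul_le_mul (mul_le_mul hp hs (abs_nonneg _) hP) ht (abs_nonneg _) (mul_nonneg hP hS)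
  have b1 := mul3 h₂ φ _ _ _ _ hh₂ hφK s1
  have hEK : |4 * α * E| ≤ 4 * α * K := by
    rw [abs_of_pos (by positivity)]; exact mul_le_mul_of_nonneg_left (by linarith) (by positivity)
  have b2 := mul3 h₁ (4 * α * E) _ _ _ _ hh₁ hEK s2
  have b3 := mul3 h₁ φ _ _ _ _ hh₁ hφK s3
  have b4 := mul3 h₁ φ _ _ _ _ hh₁ hφK s4
  -- The quadratic term in `α` cancels the drift, by Cauchy–Schwarz and `|x| ≥ rs`; the trace term,
  -- at least `4 α c₀`, is what remains.
  have main : 4 * α * c₀ * (h * E) ≤ h * E * (4 * α ^ 2 * (a * x ^ 2 + 2 * b * x * y + d * y ^ 2)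
      + 2 * α * (a + d) - 2 * α * (β₀ * x + β₁ * y)) := by
    have hsqrt : rs ≤ √q := Real.le_sqrt_of_sq_le hlow
    have hCS : β₀ * x + β₁ * y ≤ M₂ * √q := mul_add_mul_le_of_sq hM₂ hq0.le hβ rfl
    have hx := hA x y
    have hαM : M₂ ≤ 2 * α * c₀ * rs := by
      rw [hα]; field_simp; linarith
    have h1 : M₂ * √q ≤ 2 * α * c₀ * q := by
      calc M₂ * √q ≤ (2 * α * c₀ * √q) * √q := by
            apply mul_le_mul_of_nonneg_right _ (Real.sqrt_nonneg _)
            exact hαM.trans (mul_le_mul_of_nonneg_left hsqrt (by positivity))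
        _ = 2 * α * c₀ * q := by rw [mul_assoc, Real.mul_self_sqrt hq0.le]
    have h2 : β₀ * x + β₁ * y ≤ 2 * α * (a * x ^ 2 + 2 * b * x * y + d * y ^ 2) := by
      have := mul_le_mul_of_nonneg_left hx (show 0 ≤ 2 * α by positivity)
      linarith
    have h3 : 4 * α * c₀ ≤ 4 * α ^ 2 * (a * x ^ 2 + 2 * b * x * y + d * y ^ 2)
      + 2 * α * (a + d) - 2 * α * (β₀ * x + β₁ * y) := by
      have := mul_le_mul_of_nonneg_left h2 (show 0 ≤ 2 * α by positivity)
      have := mul_le_mul_of_nonneg_left (show 2 * c₀ ≤ a + d by linarith)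
        (show 0 ≤ 2 * α by positivity)
      linarith
    have := mul_le_mul_of_nonneg_left h3 (show 0 ≤ h * E by positivity)
    linarith
  have hhE : h ≤ h * E := le_mul_of_one_le_right hh.le hE1
  have main' : 4 * α * c₀ * h ≤ 4 * α * c₀ * (h * E) :=
    mul_le_mul_of_nonneg_left hhE (by positivity)
  have hsmall : ν * h * K * (3 * M₁ * (1 / rs ^ 2)) + ν * h * (4 * α * K) * (3 * M₁ * 1)
      + ν * h * K * (3 * M₁ * (1 / rs ^ 2)) + ν * h * K * (2 * M₂ / rs) ≤ 2 * α * c₀ * h := by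
    have := mul_le_mul_of_nonneg_right hνG hh.le
    calc _ = ν * G * h := by rw [hG]; ring
      _ ≤ _ := this
  have hpos : 0 < 2 * α * c₀ * h := by positivity
  have := abs_le.1 b1
  have := abs_le.1 b2
  have := abs_le.1 b3
  have := abs_le.1 b4
  linarith

/-! ### Calculus of explicit gradients -/

/-- `f` is differentiable at `x`, with gradient `(p, q)`. -/
def HasGrad (f : Plane → ℝ) (p q : ℝ) (x : Plane) : Prop :=
  HasFDerivAt f (p • (EuclideanSpace.proj 0 : Plane →L[ℝ] ℝ)
    + q • (EuclideanSpace.proj 1 : Plane →L[ℝ] ℝ)) x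

lemma HasGrad.congr_grad {f : Plane → ℝ} {p q p' q' : ℝ} {x : Plane} (h : HasGrad f p q x)
    (hp : p = p') (hq : q = q') : HasGrad f p' q' x := hp ▸ hq ▸ h

lemma hasGrad_fst (x : Plane) : HasGrad (fun y => y 0) 1 0 x := by
  unfold HasGrad
  simpa using (EuclideanSpace.proj 0 : Plane →L[ℝ] ℝ).hasFDerivAt

lemma hasGrad_snd (x : Plane) : HasGrad (fun y => y 1) 0 1 x := by
  unfold HasGrad
  simpa using (EuclideanSpace.proj 1 : Plane →L[ℝ] ℝ).hasFDerivAt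

lemma HasGrad.add {f g : Plane → ℝ} {p q p' q' : ℝ} {x : Plane} (hf : HasGrad f p q x)
    (hg : HasGrad g p' q' x) : HasGrad (fun y => f y + g y) (p + p') (q + q') x := by
  refine (HasFDerivAt.fun_add hf hg).congr_fderiv ?_
  ext v; simp; ring

lemma HasGrad.mul {f g : Plane → ℝ} {p q p' q' : ℝ} {x : Plane} (hf : HasGrad f p q x)
    (hg : HasGrad g p' q' x) :
    HasGrad (fun y => f y * g y) (p * g x + f x * p') (q * g x + f x * q') x := by
  refine (HasFDerivAt.fun_mul hf hg).congr_fderiv ?_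
  ext v; simp; ring

lemma HasGrad.const_mul {f : Plane → ℝ} {p q : ℝ} {x : Plane} (c : ℝ) (hf : HasGrad f p q x) :
    HasGrad (fun y => c * f y) (c * p) (c * q) x := by
  refine (HasFDerivAt.const_mul hf c).congr_fderiv ?_
  ext v; simp; ring

lemma HasGrad.comp {f : Plane → ℝ} {p q h' : ℝ} {x : Plane} {h : ℝ → ℝ}
    (hh : HasDerivAt h h' (f x)) (hf : HasGrad f p q x) :
    HasGrad (fun y => h (f y)) (h' * p) (h' * q) x := by
  refine (hh.comp_hasFDerivAt x hf).congr_fderiv ?_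
  ext v; simp; ring

lemma HasGrad.partialD_zero {f : Plane → ℝ} {p q : ℝ} {x : Plane} (h : HasGrad f p q x) :
    partialD 0 f x = p := by
  unfold HasGrad at h
  simp [partialD, h.fderiv]

lemma HasGrad.partialD_one {f : Plane → ℝ} {p q : ℝ} {x : Plane} (h : HasGrad f p q x) :
    partialD 1 f x = q := by
  unfold HasGrad at h
  simp [partialD, h.fderiv]

lemma partialD_congr {f g : Plane → ℝ} {x : Plane} (i : Fin 2) (h : f =ᶠ[𝓝 x] g) :
    partialD i f x = partialD i g x := by
  rw [partialD, partialD, h.fderiv_eq]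

/-! ### Hessians and the sign of `L` at a maximum -/

lemma partialD_partialD_eq {u : Plane → ℝ} {x : Plane} (hu : ContDiffAt ℝ 2 u x) (i j : Fin 2) :
    partialD i (partialD j u) x =
      fderiv ℝ (fderiv ℝ u) x (EuclideanSpace.single i 1) (EuclideanSpace.single j 1) := by
  have h : DifferentiableAt ℝ (fderiv ℝ u) x :=
    (hu.fderiv_right (m := 1) (by norm_num)).differentiableAt (by norm_num)
  have : HasFDerivAt (partialD j u) _ x :=
    (ContinuousLinearMap.apply ℝ ℝ (EuclideanSpace.single j (1 : ℝ) : Plane)).hasFDerivAt.comp x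
      h.hasFDerivAt
  rw [partialD, this.fderiv]
  rfl

/-- A function of one variable with a local maximum has a nonpositive second derivative there. -/
lemma deriv_deriv_nonpos_of_isLocalMax {g : ℝ → ℝ} {t : ℝ} (hc : ContinuousAt g t)
    (h : IsLocalMax g t) : deriv (deriv g) t ≤ 0 := by
  by_contra! hpos
  -- A positive second derivative would make the maximum also a local minimum, so `g` would be
  -- locally constant.
  have hmin := isLocalMin_of_deriv_deriv_pos hpos h.deriv_eq_zero hc
  have heq : g =ᶠ[𝓝 t] fun _ => g t := by
    filter_upwards [h, hmin] with s h1 h2 using le_antisymm h1 h2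
  have := heq.deriv.deriv_eq
  simp at this
  linarith

/-- Restriction to the line `s ↦ x + s ξ` reduces this to one variable. -/
lemma fderiv_fderiv_nonpos_of_isLocalMax {f : Plane → ℝ} {x : Plane} (hf : ContDiffAt ℝ 2 f x)
    (h : IsLocalMax f x) (ξ : Plane) : fderiv ℝ (fderiv ℝ f) x ξ ξ ≤ 0 := by
  let l : ℝ → Plane := fun s => x + s • ξ
  have hl : ∀ s, HasDerivAt l ξ s := fun s => by
    simpa [l] using ((hasDerivAt_id s).smul_const ξ).const_add x
  have hl0 : l 0 = x := by simp [l]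
  have hlc : Tendsto l (𝓝 0) (𝓝 x) := by
    have := (hl 0).continuousAt.tendsto
    rwa [hl0] at this
  have hd : ∀ᶠ y in 𝓝 x, DifferentiableAt ℝ f y :=
    (hf.eventually (by simp)).mono fun y hy => hy.differentiableAt (by norm_num)
  have hg1 : deriv (f ∘ l) =ᶠ[𝓝 0] fun s => fderiv ℝ f (l s) ξ := by
    filter_upwards [hlc.eventually hd] with s hs
    exact (hs.hasFDerivAt.comp_hasDerivAt s (hl s)).deriv
  have hD : DifferentiableAt ℝ (fderiv ℝ f) x :=
    (hf.fderiv_right (m := 1) (by norm_num)).differentiableAt (by norm_num)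
  have hg2 : deriv (deriv (f ∘ l)) 0 = fderiv ℝ (fderiv ℝ f) x ξ ξ := by
    rw [hg1.deriv_eq]
    have h1 : HasDerivAt (fun s => fderiv ℝ f (l s)) (fderiv ℝ (fderiv ℝ f) x ξ) 0 := by
      have := hD.hasFDerivAt
      rw [← hl0] at this
      have := this.comp_hasDerivAt 0 (hl 0)
      rwa [hl0] at this
    have := (ContinuousLinearMap.apply ℝ ℝ ξ).hasFDerivAt.comp_hasDerivAt 0 h1
    exact this.deriv
  rw [← hg2]
  apply deriv_deriv_nonpos_of_isLocalMax
  · exact ContinuousAt.comp (by rw [hl0]; exact hf.continuousAt) (hl 0).continuousAt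
  · have : IsLocalMax f (l 0) := by rwa [hl0]
    exact this.comp_continuous (hl 0).continuousAt

lemma quadForm_eq (M : Matrix (Fin 2) (Fin 2) ℝ) (hM : M.IsSymm) (ξ η : ℝ) :
    (∑ i, ∑ j, (!₂[ξ, η] : Plane) i * M i j * (!₂[ξ, η] : Plane) j)
      = M 0 0 * ξ ^ 2 + 2 * M 0 1 * ξ * η + M 1 1 * η ^ 2 := by
  have : M 1 0 = M 0 1 := hM.apply 0 1
  simp [Fin.sum_univ_two, this]; ring

/-- At an interior local maximum `L f ≥ 0`. -/
lemma ellipticOp_nonneg_of_isLocalMax {A : Plane → Matrix (Fin 2) (Fin 2) ℝ} {b : Plane → Plane}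
    {f : Plane → ℝ} {x : Plane} (hf : ContDiffAt ℝ 2 f x) (h : IsLocalMax f x)
    (hs : (A x).IsSymm)
    (hA : ∀ ξ η : ℝ, 0 ≤ A x 0 0 * ξ ^ 2 + 2 * A x 0 1 * ξ * η + A x 1 1 * η ^ 2)
    (hpos : 0 < A x 0 0) : 0 ≤ ellipticOp A b f x := by
  have hsym : A x 1 0 = A x 0 1 := hs.apply 0 1
  have hgrad : ∀ i, partialD i f x = 0 := fun i => by
    rw [partialD, h.fderiv_eq_zero]; rfl
  set H := fderiv ℝ (fderiv ℝ f) x with hH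
  set e0 : Plane := EuclideanSpace.single 0 1
  set e1 : Plane := EuclideanSpace.single 1 1
  set a := A x 0 0
  set c := A x 0 1
  set d := A x 1 1
  -- Completing the square: with `v = a e0 + c e1`, `a · tr(A H) = H(v, v) + (a d - c²) H(e1, e1)`,
  -- and both terms are nonpositive.
  have h1 := fderiv_fderiv_nonpos_of_isLocalMax hf h (a • e0 + c • e1)
  have h2 := fderiv_fderiv_nonpos_of_isLocalMax hf h e1
  rw [← hH] at h1 h2
  simp only [map_add, map_smul, _root_.add_apply, _root_.smul_apply,
    smul_eq_mul] at h1
  have hdet : 0 ≤ a * d - c ^ 2 := by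
    have := hA (-c) a
    have h3 : 0 ≤ a * (a * d - c ^ 2) := by linarith
    exact nonneg_of_mul_nonneg_right h3 hpos
  have hsum : a * H e0 e0 + c * H e0 e1 + c * H e1 e0 + d * H e1 e1 ≤ 0 := by
    have h3 := mul_nonpos_of_nonneg_of_nonpos hdet h2
    have h4 : a * (a * H e0 e0 + c * H e0 e1 + c * H e1 e0 + d * H e1 e1) ≤ 0 := by linarith
    by_contra! hc
    linarith [mul_pos hpos hc]
  simp only [ellipticOp, Fin.sum_univ_two, hgrad, partialD_partialD_eq hf]
  rw [hsym]
  linarith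

lemma ellipticOp_sub {A : Plane → Matrix (Fin 2) (Fin 2) ℝ} {b : Plane → Plane}
    {f g : Plane → ℝ} {x : Plane} (hf : ContDiffAt ℝ 2 f x) (hg : ContDiffAt ℝ 2 g x) :
    ellipticOp A b (fun y => f y - g y) x = ellipticOp A b f x - ellipticOp A b g x := by
  have hd : ∀ {f : Plane → ℝ}, ContDiffAt ℝ 2 f x → ∀ᶠ y in 𝓝 x, DifferentiableAt ℝ f y :=
    fun hf => (hf.eventually (by simp)).mono fun y hy => hy.differentiableAt (by norm_num)
  have hD : ∀ {f : Plane → ℝ}, ContDiffAt ℝ 2 f x → DifferentiableAt ℝ (fderiv ℝ f) x :=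
    fun hf => (hf.fderiv_right (m := 1) (by norm_num)).differentiableAt (by norm_num)
  have h1 : fderiv ℝ (fun y => f y - g y) =ᶠ[𝓝 x] fun y => fderiv ℝ f y - fderiv ℝ g y := by
    filter_upwards [hd hf, hd hg] with y h1 h2 using fderiv_fun_sub h1 h2
  have h2 : fderiv ℝ (fderiv ℝ (fun y => f y - g y)) x
      = fderiv ℝ (fderiv ℝ f) x - fderiv ℝ (fderiv ℝ g) x := by
    rw [h1.fderiv_eq, fderiv_fun_sub (hD hf) (hD hg)]
  simp only [ellipticOp, Fin.sum_univ_two, partialD_partialD_eq hf, partialD_partialD_eq hg,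
    partialD_partialD_eq (hf.sub hg), h2]
  simp only [partialD, h1.self_of_nhds, _root_.sub_apply]
  ring

lemma ellipticOp_neg {A : Plane → Matrix (Fin 2) (Fin 2) ℝ} {b : Plane → Plane}
    {f : Plane → ℝ} (x : Plane) :
    ellipticOp A b (fun y => - f y) x = - ellipticOp A b f x := by
  have h : ∀ (i : Fin 2) (f : Plane → ℝ), partialD i (fun y => - f y) = fun y => - partialD i f y := by
    intro i f; ext y
    simp [partialD, fderiv_fun_neg]
  simp only [ellipticOp, Fin.sum_univ_two, h]
  ring

/-! ### Local branches of the polar angle -/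

/-- The branch near `polar r θ` of the polar angle that takes the value `θ` there. -/
def angle (θ : ℝ) (x : Plane) : ℝ :=
  θ + Real.arctan ((-Real.sin θ * x 0 + Real.cos θ * x 1)
    / (Real.cos θ * x 0 + Real.sin θ * x 1))

/-- The half plane on which `angle θ` is a branch of the polar angle. -/
def halfPlane (θ : ℝ) : Set Plane := {x | 0 < Real.cos θ * x 0 + Real.sin θ * x 1}

lemma isOpen_halfPlane (θ : ℝ) : IsOpen (halfPlane θ) :=
  isOpen_lt continuous_const (by fun_prop)

lemma normSq_pos {θ : ℝ} {x : Plane} (hx : x ∈ halfPlane θ) : 0 < x 0 ^ 2 + x 1 ^ 2 := by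
  have hx' : 0 < Real.cos θ * x 0 + Real.sin θ * x 1 := hx
  by_contra! h
  have h0 : x 0 = 0 := by nlinarith [sq_nonneg (x 0), sq_nonneg (x 1)]
  have h1 : x 1 = 0 := by nlinarith [sq_nonneg (x 0), sq_nonneg (x 1)]
  simp [h0, h1] at hx'

lemma rotate_normSq (θ p q : ℝ) :
    (Real.cos θ * p + Real.sin θ * q) ^ 2 + (-Real.sin θ * p + Real.cos θ * q) ^ 2
      = p ^ 2 + q ^ 2 := by
  linear_combination (p ^ 2 + q ^ 2) * Real.sin_sq_add_cos_sq θ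

/-- Rotating `x` by `-θ` gives a point `(D, N)` with `D > 0`, whose argument is `arctan (N / D)`. -/
lemma polar_angle {θ : ℝ} {x : Plane} (hx : x ∈ halfPlane θ) :
    polar √(x 0 ^ 2 + x 1 ^ 2) (angle θ x) = x := by
  have hq := normSq_pos hx
  have hrot := rotate_normSq θ (x 0) (x 1)
  have hx' : 0 < Real.cos θ * x 0 + Real.sin θ * x 1 := hx
  have hcs := Real.sin_sq_add_cos_sq θ
  rw [angle]
  generalize hD : Real.cos θ * x 0 + Real.sin θ * x 1 = D at *
  generalize hN : -Real.sin θ * x 0 + Real.cos θ * x 1 = N at *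
  generalize hqq : x 0 ^ 2 + x 1 ^ 2 = q at *
  have hsqrt : √(1 + (N / D) ^ 2) = √q / D := by
    rw [show 1 + (N / D) ^ 2 = q / D ^ 2 by field_simp; linarith, Real.sqrt_div hq.le,
      Real.sqrt_sq hx'.le]
  have hs : 0 < √q := Real.sqrt_pos.2 hq
  have hc : √q * Real.cos (Real.arctan (N / D)) = D := by
    rw [Real.cos_arctan, hsqrt]; field_simp
  have hsn : √q * Real.sin (Real.arctan (N / D)) = N := by
    rw [Real.sin_arctan, hsqrt]; field_simp
  ext i
  fin_cases i
  · simp only [polar, Real.cos_add]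
    simp
    linear_combination Real.cos θ * hc - Real.sin θ * hsn - Real.cos θ * hD + Real.sin θ * hN
      + x 0 * hcs
  · simp only [polar, Real.sin_add]
    simp
    linear_combination Real.sin θ * hc + Real.cos θ * hsn - Real.sin θ * hD - Real.cos θ * hN
      + x 1 * hcs

lemma polar_mem_halfPlane {r θ : ℝ} (hr : 0 < r) : polar r θ ∈ halfPlane θ := by
  show 0 < Real.cos θ * (r * Real.cos θ) + Real.sin θ * (r * Real.sin θ)
  have : Real.cos θ * (r * Real.cos θ) + Real.sin θ * (r * Real.sin θ) = r := by
    linear_combination r * Real.sin_sq_add_cos_sq θ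
  rwa [this]

lemma angle_polar (r θ : ℝ) : angle θ (polar r θ) = θ := by
  have : -Real.sin θ * (polar r θ) 0 + Real.cos θ * (polar r θ) 1 = 0 := by
    simp [polar]; ring
  simp only [angle, this]; simp

lemma normSq_polar (r θ : ℝ) : (polar r θ) 0 ^ 2 + (polar r θ) 1 ^ 2 = r ^ 2 := by
  simp [polar]
  linear_combination r ^ 2 * Real.sin_sq_add_cos_sq θ

lemma contDiffAt_angle {θ : ℝ} {x : Plane} (hx : x ∈ halfPlane θ) :
    ContDiffAt ℝ 2 (angle θ) x := by
  have hx' : Real.cos θ * x 0 + Real.sin θ * x 1 ≠ 0 := ne_of_gt hx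
  unfold angle
  have h0 : ContDiff ℝ 2 (fun y : Plane => y 0) := (EuclideanSpace.proj 0 : Plane →L[ℝ] ℝ).contDiff
  have h1 : ContDiff ℝ 2 (fun y : Plane => y 1) := (EuclideanSpace.proj 1 : Plane →L[ℝ] ℝ).contDiff
  refine contDiffAt_const.add (Real.contDiff_arctan.contDiffAt.comp x (ContDiffAt.div ?_ ?_ hx'))
  · exact ((contDiff_const.mul h0).add (contDiff_const.mul h1)).contDiffAt
  · exact ((contDiff_const.mul h0).add (contDiff_const.mul h1)).contDiffAt

/-- All branches differ by constants, so the gradient does not involve `θ`. -/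
lemma hasGrad_angle {θ : ℝ} {x : Plane} (hx : x ∈ halfPlane θ) :
    HasGrad (angle θ) (-x 1 / (x 0 ^ 2 + x 1 ^ 2)) (x 0 / (x 0 ^ 2 + x 1 ^ 2)) x := by
  have hx' : Real.cos θ * x 0 + Real.sin θ * x 1 ≠ 0 := ne_of_gt hx
  have hq := (normSq_pos hx).ne'
  have hN := ((hasGrad_fst x).const_mul (-Real.sin θ)).add ((hasGrad_snd x).const_mul (Real.cos θ))
  have hD := ((hasGrad_fst x).const_mul (Real.cos θ)).add ((hasGrad_snd x).const_mul (Real.sin θ))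
  have hinv := HasGrad.comp (h := fun t => t⁻¹) (hasDerivAt_inv hx') hD
  have h := HasGrad.comp (h := fun t => θ + Real.arctan t)
    ((Real.hasDerivAt_arctan _).const_add θ) (hN.mul hinv)
  have hcs := Real.sin_sq_add_cos_sq θ
  have hrot := rotate_normSq θ (x 0) (x 1)
  refine HasGrad.congr_grad (f := angle θ) h ?_ ?_
  all_goals
    clear h hinv hN hD
    generalize hD : Real.cos θ * x 0 + Real.sin θ * x 1 = D at *
    generalize hN : -Real.sin θ * x 0 + Real.cos θ * x 1 = N at *
    generalize hqq : x 0 ^ 2 + x 1 ^ 2 = q at *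
    rw [show 1 + (N * D⁻¹) ^ 2 = q / D ^ 2 by field_simp; linarith]
    field_simp
    rw [← hD, ← hN]
  · linear_combination (-x 1) * hcs
  · linear_combination (x 0) * hcs

/-! ### The barrier and its image under `L` -/

/-- The radial factor of the barrier, as a function of `|x|²`. -/
def radial (α R q : ℝ) : ℝ := 2 * Real.exp (α * R ^ 2) - Real.exp (α * q)

lemma le_radial {α R q : ℝ} (hα : 0 ≤ α) (hq : q ≤ R ^ 2) : Real.exp (α * R ^ 2) ≤ radial α R q := by
  have : Real.exp (α * q) ≤ Real.exp (α * R ^ 2) :=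
    Real.exp_le_exp.2 (mul_le_mul_of_nonneg_left hq hα)
  unfold radial; linarith

lemma radial_le (α R q : ℝ) : radial α R q ≤ 2 * Real.exp (α * R ^ 2) := by
  have := Real.exp_pos (α * q)
  unfold radial; linarith

lemma hasDerivAt_radial (α R q : ℝ) :
    HasDerivAt (radial α R) (-(α * Real.exp (α * q))) q := by
  have h := (((hasDerivAt_id q).const_mul α).exp).const_sub (2 * Real.exp (α * R ^ 2))
  refine h.congr_deriv ?_
  simp; ring

/-- The barrier `h(θ) φ(|x|²)`, written near the ray of angle `θ`. -/
def barrier (α R : ℝ) (h : ℝ → ℝ) (θ : ℝ) (x : Plane) : ℝ :=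
  h (angle θ x) * radial α R (x 0 ^ 2 + x 1 ^ 2)

lemma hasGrad_normSq (x : Plane) :
    HasGrad (fun y => y 0 ^ 2 + y 1 ^ 2) (2 * x 0) (2 * x 1) x := by
  have h := ((hasGrad_fst x).mul (hasGrad_fst x)).add ((hasGrad_snd x).mul (hasGrad_snd x))
  have e : (fun y : Plane => y 0 ^ 2 + y 1 ^ 2) = fun y => y 0 * y 0 + y 1 * y 1 := by
    ext y; ring
  rw [e]
  exact h.congr_grad (by ring) (by ring)

section
variable {α R θ : ℝ} {h h₁ h₂ : ℝ → ℝ}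

lemma contDiffAt_barrier (hh : ContDiff ℝ 2 h) {x : Plane} (hx : x ∈ halfPlane θ) :
    ContDiffAt ℝ 2 (barrier α R h θ) x := by
  have h0 : ContDiff ℝ 2 (fun y : Plane => y 0) := (EuclideanSpace.proj 0 : Plane →L[ℝ] ℝ).contDiff
  have h1 : ContDiff ℝ 2 (fun y : Plane => y 1) := (EuclideanSpace.proj 1 : Plane →L[ℝ] ℝ).contDiff
  unfold barrier radial
  exact (hh.contDiffAt.comp x (contDiffAt_angle hx)).mul
    (contDiff_const.sub (contDiff_const.mul ((h0.pow 2).add (h1.pow 2))).exp).contDiffAt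

lemma hasGrad_barrier (hd : ∀ t, HasDerivAt h (h₁ t) t) {x : Plane} (hx : x ∈ halfPlane θ) :
    HasGrad (barrier α R h θ)
      (h₁ (angle θ x) * (-x 1 / (x 0 ^ 2 + x 1 ^ 2)) * radial α R (x 0 ^ 2 + x 1 ^ 2)
        - h (angle θ x) * (2 * x 0 * (α * Real.exp (α * (x 0 ^ 2 + x 1 ^ 2)))))
      (h₁ (angle θ x) * (x 0 / (x 0 ^ 2 + x 1 ^ 2)) * radial α R (x 0 ^ 2 + x 1 ^ 2)
        - h (angle θ x) * (2 * x 1 * (α * Real.exp (α * (x 0 ^ 2 + x 1 ^ 2))))) x := by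
  have := (HasGrad.comp (hd _) (hasGrad_angle hx)).mul
    (HasGrad.comp (hasDerivAt_radial α R _) (hasGrad_normSq x))
  exact this.congr_grad (by ring) (by ring)

lemma hasGrad_exp_normSq (x : Plane) :
    HasGrad (fun y => Real.exp (α * (y 0 ^ 2 + y 1 ^ 2)))
      (2 * x 0 * (α * Real.exp (α * (x 0 ^ 2 + x 1 ^ 2))))
      (2 * x 1 * (α * Real.exp (α * (x 0 ^ 2 + x 1 ^ 2)))) x := by
  have h := HasGrad.comp (h := fun t => Real.exp t) (Real.hasDerivAt_exp _)
    ((hasGrad_normSq x).const_mul α)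
  exact h.congr_grad (by ring) (by ring)

lemma hasGrad_inv_normSq {x : Plane} (hq : x 0 ^ 2 + x 1 ^ 2 ≠ 0) :
    HasGrad (fun y => (y 0 ^ 2 + y 1 ^ 2)⁻¹) (-(2 * x 0) / (x 0 ^ 2 + x 1 ^ 2) ^ 2)
      (-(2 * x 1) / (x 0 ^ 2 + x 1 ^ 2) ^ 2) x := by
  have h := HasGrad.comp (h := fun t => t⁻¹) (hasDerivAt_inv hq) (hasGrad_normSq x)
  exact h.congr_grad (by ring) (by ring)

/-- The gradient of a component of the gradient of the barrier. -/
lemma hasGrad_barrier_component (hd : ∀ t, HasDerivAt h (h₁ t) t)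
    (hd₁ : ∀ t, HasDerivAt h₁ (h₂ t) t) {x : Plane} (hx : x ∈ halfPlane θ) {v w : Plane → ℝ}
    {v₀ v₁ w₀ w₁ : ℝ} (hv : HasGrad v v₀ v₁ x) (hw : HasGrad w w₀ w₁ x)
    {t₀ t₁ E φ : ℝ} (ht₀ : t₀ = -x 1 / (x 0 ^ 2 + x 1 ^ 2)) (ht₁ : t₁ = x 0 / (x 0 ^ 2 + x 1 ^ 2))
    (hE : E = Real.exp (α * (x 0 ^ 2 + x 1 ^ 2))) (hφ : φ = radial α R (x 0 ^ 2 + x 1 ^ 2)) :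
    HasGrad (fun y => h₁ (angle θ y) * v y * radial α R (y 0 ^ 2 + y 1 ^ 2)
        - h (angle θ y) * (w y * (α * Real.exp (α * (y 0 ^ 2 + y 1 ^ 2)))))
      (h₂ (angle θ x) * t₀ * v x * φ + h₁ (angle θ x) * v₀ * φ
        - h₁ (angle θ x) * v x * (2 * x 0 * (α * E))
        - h₁ (angle θ x) * t₀ * (w x * (α * E))
        - h (angle θ x) * (w₀ * (α * E) + w x * (2 * x 0 * (α ^ 2 * E))))
      (h₂ (angle θ x) * t₁ * v x * φ + h₁ (angle θ x) * v₁ * φ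
        - h₁ (angle θ x) * v x * (2 * x 1 * (α * E))
        - h₁ (angle θ x) * t₁ * (w x * (α * E))
        - h (angle θ x) * (w₁ * (α * E) + w x * (2 * x 1 * (α ^ 2 * E)))) x := by
  have H1 := ((HasGrad.comp (hd₁ _) (hasGrad_angle hx)).mul hv).mul
    (HasGrad.comp (hasDerivAt_radial α R _) (hasGrad_normSq x))
  have H2 := ((HasGrad.comp (hd _) (hasGrad_angle hx)).mul
    (hw.mul ((hasGrad_exp_normSq (α := α) x).const_mul α))).const_mul (-1)
  have H := H1.add H2
  have e : (fun y : Plane => h₁ (angle θ y) * v y * radial α R (y 0 ^ 2 + y 1 ^ 2)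
        - h (angle θ y) * (w y * (α * Real.exp (α * (y 0 ^ 2 + y 1 ^ 2))))) =
      fun y => h₁ (angle θ y) * v y * radial α R (y 0 ^ 2 + y 1 ^ 2)
        + -1 * (h (angle θ y) * (w y * (α * Real.exp (α * (y 0 ^ 2 + y 1 ^ 2))))) := by
    ext y; ring
  rw [e]
  refine H.congr_grad ?_ ?_
  · rw [← ht₀, ← hE, ← hφ]; ring
  · rw [← ht₁, ← hE, ← hφ]; ring

/-- The right-hand side has exactly the shape shown positive in `exists_barrier_constants`. Here
`(t₀, t₁)` is the gradient of the angle, and `d₀, d₁, -d₀` are its second derivatives: the angle is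
harmonic. -/
lemma ellipticOp_barrier (A : Plane → Matrix (Fin 2) (Fin 2) ℝ) (b : Plane → Plane)
    (hd : ∀ t, HasDerivAt h (h₁ t) t) (hd₁ : ∀ t, HasDerivAt h₁ (h₂ t) t)
    {p : Plane} (hp : p ∈ halfPlane θ) (hs : (A p).IsSymm)
    {x y t₀ t₁ d₀ d₁ E φ H H₁ H₂ : ℝ} (hx : x = p 0) (hy : y = p 1)
    (ht₀ : t₀ = -y / (x ^ 2 + y ^ 2)) (ht₁ : t₁ = x / (x ^ 2 + y ^ 2))
    (hd₀ : d₀ = 2 * x * y / (x ^ 2 + y ^ 2) ^ 2) (hd₁' : d₁ = (y ^ 2 - x ^ 2) / (x ^ 2 + y ^ 2) ^ 2)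
    (hE : E = Real.exp (α * (x ^ 2 + y ^ 2))) (hφ : φ = radial α R (x ^ 2 + y ^ 2))
    (hH : H = h (angle θ p)) (hH₁ : H₁ = h₁ (angle θ p)) (hH₂ : H₂ = h₂ (angle θ p)) :
    ellipticOp A b (barrier α R h θ) p =
      -(A p 0 0 * (H₂ * t₀ ^ 2 * φ - 4 * H₁ * t₀ * x * (α * E) + H₁ * φ * d₀
              - H * (4 * x ^ 2 * (α ^ 2 * E) + 2 * (α * E)))
            + 2 * A p 0 1 * (H₂ * t₀ * t₁ * φ - 2 * H₁ * (α * E) * (t₀ * y + t₁ * x) + H₁ * φ * d₁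
              - H * (4 * x * y * (α ^ 2 * E)))
            + A p 1 1 * (H₂ * t₁ ^ 2 * φ - 4 * H₁ * t₁ * y * (α * E) - H₁ * φ * d₀
              - H * (4 * y ^ 2 * (α ^ 2 * E) + 2 * (α * E))))
          + (b p 0 * (H₁ * t₀ * φ - H * (2 * x * (α * E)))
            + b p 1 * (H₁ * t₁ * φ - H * (2 * y * (α * E)))) := by
  have hsym : A p 1 0 = A p 0 1 := hs.apply 0 1
  have hq : p 0 ^ 2 + p 1 ^ 2 ≠ 0 := (normSq_pos hp).ne'
  have hnb : ∀ᶠ y in 𝓝 p, y ∈ halfPlane θ := (isOpen_halfPlane θ).mem_nhds hp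
  have g0 : partialD 0 (barrier α R h θ) =ᶠ[𝓝 p] _ :=
    hnb.mono fun y hy => (hasGrad_barrier hd hy).partialD_zero
  have g1 : partialD 1 (barrier α R h θ) =ᶠ[𝓝 p] _ :=
    hnb.mono fun y hy => (hasGrad_barrier hd hy).partialD_one
  have hv0 : HasGrad (fun y => -y 1 / (y 0 ^ 2 + y 1 ^ 2)) d₀ d₁ p := by
    have := ((hasGrad_snd p).const_mul (-1)).mul (hasGrad_inv_normSq hq)
    have e : (fun y : Plane => -y 1 / (y 0 ^ 2 + y 1 ^ 2))
        = fun y => -1 * y 1 * (y 0 ^ 2 + y 1 ^ 2)⁻¹ := by ext y; rw [div_eq_mul_inv]; ring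
    rw [e]
    refine this.congr_grad ?_ ?_
    · rw [hd₀, hx, hy]; ring
    · rw [hd₁', hx, hy]; field_simp; ring
  have hv1 : HasGrad (fun y => y 0 / (y 0 ^ 2 + y 1 ^ 2)) d₁ (-d₀) p := by
    have := (hasGrad_fst p).mul (hasGrad_inv_normSq hq)
    refine HasGrad.congr_grad (f := fun y => y 0 / (y 0 ^ 2 + y 1 ^ 2)) this ?_ ?_
    · rw [hd₁', hx, hy]; field_simp; ring
    · rw [hd₀, hx, hy]; ring
  have hw0 := (hasGrad_fst p).const_mul 2
  have hw1 := (hasGrad_snd p).const_mul 2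
  subst hx hy
  have c0 := hasGrad_barrier_component (R := R) hd hd₁ hp hv0 hw0 ht₀ ht₁ hE hφ
  have c1 := hasGrad_barrier_component (R := R) hd hd₁ hp hv1 hw1 ht₀ ht₁ hE hφ
  have p0 := (hasGrad_barrier (α := α) (R := R) hd hp).partialD_zero
  have p1 := (hasGrad_barrier (α := α) (R := R) hd hp).partialD_one
  simp only [ellipticOp, Fin.sum_univ_two, partialD_congr _ g0, partialD_congr _ g1, hsym,
    c0.partialD_zero, c0.partialD_one, c1.partialD_zero, c1.partialD_one, p0, p1]
  rw [← ht₀, ← ht₁, ← hE, ← hφ, ← hH, ← hH₁, ← hH₂]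
  ring

end

/-! ### Geometry of the spiral and interior maxima -/

lemma IsSpiral.mono {T T' rs : ℝ} {r₁ r₂ : ℝ → ℝ} (h : IsSpiral T r₁ r₂ rs) (hT : T ≤ T') :
    IsSpiral T' r₁ r₂ rs where
  rs_pos := h.rs_pos
  cont₁ := h.cont₁.mono (Ici_subset_Ici.2 hT)
  cont₂ := h.cont₂.mono (Ici_subset_Ici.2 hT)
  pos₁ θ hθ := h.pos₁ θ (hT.trans hθ)
  pos₂ θ hθ := h.pos₂ θ (hT.trans hθ)
  turn θ hθ := h.turn θ (hT.trans hθ)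
  lt θ hθ := h.lt θ (hT.trans hθ)
  lim₁ := h.lim₁
  lim₂ := h.lim₂

/-- The inner radius decreases along the windings, so it stays above its limit. -/
lemma IsSpiral.rs_le {T rs : ℝ} {r₁ r₂ : ℝ → ℝ} (h : IsSpiral T r₁ r₂ rs) {θ : ℝ} (hθ : T ≤ θ) :
    rs ≤ r₁ θ := by
  have hpi := Real.pi_pos
  have hanti : Antitone fun n : ℕ => r₁ (θ + n * (2 * Real.pi)) := by
    apply antitone_nat_of_succ_le
    intro n
    have h0 : T ≤ θ + n * (2 * Real.pi) := hθ.trans (le_add_of_nonneg_right (by positivity))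
    have e : θ + ((n + 1 : ℕ) : ℝ) * (2 * Real.pi) = θ + n * (2 * Real.pi) + 2 * Real.pi := by
      push_cast; ring
    rw [e]
    exact ((h.lt _ (by linarith)).trans (h.turn _ h0)).le
  have ht : Tendsto (fun n : ℕ => θ + n * (2 * Real.pi)) atTop atTop :=
    tendsto_atTop_add_const_left _ _
      (tendsto_natCast_atTop_atTop.atTop_mul_const (by positivity))
  have := hanti.le_of_tendsto (h.lim₁.comp ht) 0
  simpa using this

/-- `u` solves `L u = 0` in the spiral domain beyond the angle `T`, is continuous up to the
boundary and is below exponential growth. -/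
structure IsSolution (T : ℝ) (r₁ r₂ : ℝ → ℝ) (rs R c₀ M₁ M₂ : ℝ)
    (A : Plane → Matrix (Fin 2) (Fin 2) ℝ) (b : Plane → Plane) (u : Plane → ℝ) : Prop where
  spiral : IsSpiral T r₁ r₂ rs
  le : ∀ θ, T ≤ θ → r₂ θ ≤ R
  elliptic : IsElliptic (dom T r₁ r₂) A c₀ M₁
  drift : ∀ x ∈ dom T r₁ r₂, ‖b x‖ ≤ M₂
  smooth : ContDiffOn ℝ 2 u (dom T r₁ r₂)
  cont : ContinuousOn u (domTilde T r₁ r₂)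
  growth : BelowExpGrowth r₁ r₂ u
  eq : ∀ x ∈ dom T r₁ r₂, ellipticOp A b u x = 0

lemma dom_anti {T T' : ℝ} (r₁ r₂ : ℝ → ℝ) (hT : T ≤ T') : dom T' r₁ r₂ ⊆ dom T r₁ r₂ := by
  rintro x ⟨r, θ, h, h'⟩
  exact ⟨r, θ, hT.trans_lt h, h'⟩

lemma domTilde_anti {T T' : ℝ} (r₁ r₂ : ℝ → ℝ) (hT : T ≤ T') :
    domTilde T' r₁ r₂ ⊆ domTilde T r₁ r₂ := by
  rintro x ⟨r, θ, h, h'⟩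
  exact ⟨r, θ, hT.trans h, h'⟩

lemma continuous_polar : Continuous fun p : ℝ × ℝ => polar p.1 p.2 := by
  unfold polar; fun_prop

namespace IsSolution
variable {T : ℝ} {r₁ r₂ : ℝ → ℝ} {rs R c₀ M₁ M₂ : ℝ}
    {A : Plane → Matrix (Fin 2) (Fin 2) ℝ} {b : Plane → Plane} {u : Plane → ℝ}

lemma mono {T' : ℝ} (h : IsSolution T r₁ r₂ rs R c₀ M₁ M₂ A b u) (hT : T ≤ T') :
    IsSolution T' r₁ r₂ rs R c₀ M₁ M₂ A b u where
  spiral := h.spiral.mono hT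
  le θ hθ := h.le θ (hT.trans hθ)
  elliptic :=
    { symm := fun x hx => h.elliptic.symm x (dom_anti r₁ r₂ hT hx)
      lower := fun x hx => h.elliptic.lower x (dom_anti r₁ r₂ hT hx)
      trace_le := fun x hx => h.elliptic.trace_le x (dom_anti r₁ r₂ hT hx) }
  drift x hx := h.drift x (dom_anti r₁ r₂ hT hx)
  smooth := h.smooth.mono (dom_anti r₁ r₂ hT)
  cont := h.cont.mono (domTilde_anti r₁ r₂ hT)
  growth := h.growth
  eq x hx := h.eq x (dom_anti r₁ r₂ hT hx)

lemma neg (h : IsSolution T r₁ r₂ rs R c₀ M₁ M₂ A b u) :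
    IsSolution T r₁ r₂ rs R c₀ M₁ M₂ A b (fun x => - u x) where
  spiral := h.spiral
  le := h.le
  elliptic := h.elliptic
  drift := h.drift
  smooth := h.smooth.neg
  cont := h.cont.neg
  growth := by simpa [BelowExpGrowth] using h.growth
  eq x hx := by rw [ellipticOp_neg, h.eq x hx, neg_zero]

lemma isCompact_crossSection (θ : ℝ) : IsCompact (crossSection r₁ r₂ θ) := by
  have : crossSection r₁ r₂ θ = (fun r => polar r θ) '' Icc (r₁ θ) (r₂ θ) := by
    ext x; constructor
    · rintro ⟨r, h1, h2, rfl⟩; exact ⟨r, ⟨h1, h2⟩, rfl⟩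
    · rintro ⟨r, ⟨h1, h2⟩, rfl⟩; exact ⟨r, h1, h2, rfl⟩
  rw [this]
  exact isCompact_Icc.image (continuous_polar.comp (continuous_id.prodMk continuous_const))

lemma crossSection_subset {θ : ℝ} (hθ : T ≤ θ) : crossSection r₁ r₂ θ ⊆ domTilde T r₁ r₂ := by
  rintro x ⟨r, h1, h2, rfl⟩
  exact ⟨r, θ, hθ, h1, h2, rfl⟩

lemma abs_le_sSup (h : IsSolution T r₁ r₂ rs R c₀ M₁ M₂ A b u) {θ r : ℝ} (hθ : T ≤ θ)
    (h1 : r₁ θ ≤ r) (h2 : r ≤ r₂ θ) :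
    |u (polar r θ)| ≤ sSup ((fun x => |u x|) '' crossSection r₁ r₂ θ) := by
  apply le_csSup
  · exact ((isCompact_crossSection θ).image_of_continuousOn
      (h.cont.mono (crossSection_subset hθ)).abs).bddAbove
  · exact ⟨_, ⟨r, h1, h2, rfl⟩, rfl⟩

lemma isCompact_strip (h : IsSolution T r₁ r₂ rs R c₀ M₁ M₂ A b u) (T' : ℝ) :
    IsCompact {p : ℝ × ℝ | T ≤ p.2 ∧ p.2 ≤ T' ∧ r₁ p.2 ≤ p.1 ∧ p.1 ≤ r₂ p.2} := by
  -- Interpolating between the two radii parametrizes the strip by a rectangle.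
  have : {p : ℝ × ℝ | T ≤ p.2 ∧ p.2 ≤ T' ∧ r₁ p.2 ≤ p.1 ∧ p.1 ≤ r₂ p.2} =
      (fun p : ℝ × ℝ => (r₁ p.2 + p.1 * (r₂ p.2 - r₁ p.2), p.2)) '' (Icc 0 1 ×ˢ Icc T T') := by
    ext ⟨r, θ⟩
    simp only [mem_ofPred_eq, mem_image, mem_prod, mem_Icc, Prod.exists, Prod.mk.injEq]
    constructor
    · rintro ⟨h1, h2, h3, h4⟩
      have hlt := h.spiral.lt θ h1
      have hp : 0 < r₂ θ - r₁ θ := by linarith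
      refine ⟨(r - r₁ θ) / (r₂ θ - r₁ θ), θ,
        ⟨⟨div_nonneg (by linarith) hp.le, (div_le_one hp).2 (by linarith)⟩, h1, h2⟩, ?_, rfl⟩
      field_simp; ring
    · rintro ⟨s, t, ⟨⟨h1, h2⟩, h3, h4⟩, h5, rfl⟩
      have hlt := h.spiral.lt t h3
      refine ⟨h3, h4, ?_, ?_⟩ <;> nlinarith
  rw [this]
  apply (isCompact_Icc.prod isCompact_Icc).image_of_continuousOn
  have m : MapsTo (fun p : ℝ × ℝ => p.2) (Icc 0 1 ×ˢ Icc T T') (Ici T) := fun p hp => hp.2.1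
  have k1 := h.spiral.cont₁.comp continuous_snd.continuousOn m
  have k2 := h.spiral.cont₂.comp continuous_snd.continuousOn m
  exact (k1.add (continuous_fst.continuousOn.mul (k2.sub k1))).prodMk continuous_snd.continuousOn

/-- Near an interior point the polar coordinates are local coordinates. -/
lemma eventually_polar (h : IsSolution T r₁ r₂ rs R c₀ M₁ M₂ A b u) {r θ : ℝ} (hθ : T < θ)
    (h1 : r₁ θ < r) (h2 : r < r₂ θ) {T' : ℝ} (hT' : θ < T') :
    ∀ᶠ x in 𝓝 (polar r θ), x ∈ halfPlane θ ∧ T < angle θ x ∧ angle θ x < T' ∧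
      r₁ (angle θ x) < √(x 0 ^ 2 + x 1 ^ 2) ∧ √(x 0 ^ 2 + x 1 ^ 2) < r₂ (angle θ x) := by
  have hr : 0 < r := (h.spiral.pos₁ θ hθ.le).trans h1
  have hmem := polar_mem_halfPlane (θ := θ) hr
  have hang : ContinuousAt (angle θ) (polar r θ) := (contDiffAt_angle hmem).continuousAt
  have hrad : ContinuousAt (fun x : Plane => √(x 0 ^ 2 + x 1 ^ 2)) (polar r θ) :=
    Continuous.continuousAt (by fun_prop)
  have hav := angle_polar r θ
  have hrv : √((polar r θ) 0 ^ 2 + (polar r θ) 1 ^ 2) = r := by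
    rw [normSq_polar, Real.sqrt_sq hr.le]
  have hnb : Ici T ∈ 𝓝 θ := Ici_mem_nhds hθ
  have c1 : ContinuousAt r₁ (angle θ (polar r θ)) := by
    rw [hav]; exact h.spiral.cont₁.continuousAt hnb
  have c2 : ContinuousAt r₂ (angle θ (polar r θ)) := by
    rw [hav]; exact h.spiral.cont₂.continuousAt hnb
  have e1 := (c1.comp hang).eventually_lt hrad (by simpa [hav, hrv] using h1)
  have e2 := hrad.eventually_lt (c2.comp hang) (by simpa [hav, hrv] using h2)
  have e3 : ∀ᶠ x in 𝓝 (polar r θ), T < angle θ x :=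
    hang.eventually_const_lt (by rwa [hav])
  have e4 : ∀ᶠ x in 𝓝 (polar r θ), angle θ x < T' :=
    hang.eventually_lt_const (by rwa [hav])
  filter_upwards [(isOpen_halfPlane θ).mem_nhds hmem, e1, e2, e3, e4] with x a1 a2 a3 a4 a5
  exact ⟨a1, a4, a5, a2, a3⟩

lemma normSq_le (h : IsSolution T r₁ r₂ rs R c₀ M₁ M₂ A b u) {r θ : ℝ} (hθ : T ≤ θ)
    (h1 : r₁ θ ≤ r) (h2 : r ≤ r₂ θ) : r ^ 2 ≤ R ^ 2 := by
  have hr : 0 < r := (h.spiral.pos₁ θ hθ).trans_le h1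
  have : r ≤ R := h2.trans (h.le θ hθ)
  gcongr

/-- `u` minus a function on which `L` is positive has no interior maximum. -/
lemma not_interior_max (h : IsSolution T r₁ r₂ rs R c₀ M₁ M₂ A b u) (hc₀ : 0 < c₀)
    {α : ℝ} {f : ℝ → ℝ} (hf : ContDiff ℝ 2 f)
    (hL : ∀ x ∈ dom T r₁ r₂, ∀ θ, x ∈ halfPlane θ → rs ^ 2 ≤ x 0 ^ 2 + x 1 ^ 2 →
      x 0 ^ 2 + x 1 ^ 2 ≤ R ^ 2 → 0 < ellipticOp A b (barrier α R f θ) x)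
    {r θ T' : ℝ} (hθ : T < θ) (hT' : θ < T') (h1 : r₁ θ < r) (h2 : r < r₂ θ)
    (hmax : ∀ r' θ', T ≤ θ' → θ' ≤ T' → r₁ θ' ≤ r' → r' ≤ r₂ θ' →
      u (polar r' θ') - f θ' * radial α R (r' ^ 2) ≤ u (polar r θ) - f θ * radial α R (r ^ 2)) :
    False := by
  set p := polar r θ with hp
  have hr : 0 < r := (h.spiral.pos₁ θ hθ.le).trans h1
  have hmem : p ∈ halfPlane θ := polar_mem_halfPlane hr
  have hev := h.eventually_polar hθ h1 h2 hT'
  have hnb : dom T r₁ r₂ ∈ 𝓝 p := by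
    filter_upwards [hev] with x hx
    exact ⟨_, _, hx.2.1, hx.2.2.2.1, hx.2.2.2.2, (polar_angle hx.1).symm⟩
  have hpd : p ∈ dom T r₁ r₂ := mem_of_mem_nhds hnb
  have hu : ContDiffAt ℝ 2 u p := h.smooth.contDiffAt hnb
  have hb : ContDiffAt ℝ 2 (barrier α R f θ) p := contDiffAt_barrier hf hmem
  -- Maximality is known in the `(r, θ)` strip, where the barrier is single-valued; the local branch
  -- of the angle carries it to the plane.
  have hloc : IsLocalMax (fun y => u y - barrier α R f θ y) p := by
    filter_upwards [hev] with x hx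
    have := hmax _ _ hx.2.1.le hx.2.2.1.le hx.2.2.2.1.le hx.2.2.2.2.le
    rw [polar_angle hx.1, Real.sq_sqrt (by positivity)] at this
    rw [barrier, barrier, hp, angle_polar, normSq_polar]
    exact this
  have hquad : ∀ ξ η : ℝ, c₀ * (ξ ^ 2 + η ^ 2) ≤
      A p 0 0 * ξ ^ 2 + 2 * A p 0 1 * ξ * η + A p 1 1 * η ^ 2 := fun ξ η => by
    have := h.elliptic.lower p hpd !₂[ξ, η]
    rw [quadForm_eq _ (h.elliptic.symm p hpd), EuclideanSpace.norm_sq_eq] at this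
    simpa [Fin.sum_univ_two] using this
  have hnn := ellipticOp_nonneg_of_isLocalMax (b := b) (hu.sub hb) hloc (h.elliptic.symm p hpd)
    (fun ξ η => (by positivity : 0 ≤ c₀ * (ξ ^ 2 + η ^ 2)).trans (hquad ξ η))
    (by have := hquad 1 0; norm_num at this; linarith)
  rw [ellipticOp_sub hu hb, h.eq p hpd] at hnn
  have hrs : rs ≤ r := (h.spiral.rs_le hθ.le).trans h1.le
  have hpos := hL p hpd θ hmem
    (by rw [hp, normSq_polar]; have := h.spiral.rs_pos; gcongr)
    (by rw [hp, normSq_polar]; exact h.normSq_le hθ.le h1.le h2.le)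
  linarith

end IsSolution

/-! ### Comparison on truncated strips -/

/-- Comparison with the barrier: boundary values at most `P` on the sides and at most `P + κ` on
the initial cross-section force `u ≤ P` up to an exponentially small error. -/
theorem exists_decay_rate (rs R c₀ M₁ M₂ : ℝ) (hrs : 0 < rs) (hc₀ : 0 < c₀) (hM₁ : 0 < M₁)
    (hM₂ : 0 ≤ M₂) :
    ∃ ν : ℝ, 0 < ν ∧ ∀ (T : ℝ) (r₁ r₂ : ℝ → ℝ) (A : Plane → Matrix (Fin 2) (Fin 2) ℝ)
      (b : Plane → Plane) (u : Plane → ℝ), IsSolution T r₁ r₂ rs R c₀ M₁ M₂ A b u →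
      ∀ P κ : ℝ, 0 ≤ κ →
      (∀ θ, T ≤ θ → u (polar (r₁ θ) θ) ≤ P) → (∀ θ, T ≤ θ → u (polar (r₂ θ) θ) ≤ P) →
      (∀ r, r₁ T ≤ r → r ≤ r₂ T → u (polar r T) ≤ P + κ) →
      ∀ r θ, T ≤ θ → r₁ θ ≤ r → r ≤ r₂ θ →
        u (polar r θ) ≤ P + 2 * κ * Real.exp (-ν * (θ - T)) := by
  obtain ⟨α, ν, hα, hν, hν1, hbar⟩ := exists_barrier_constants rs R c₀ M₁ M₂ hrs hc₀ hM₁ hM₂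
  refine ⟨ν, hν, ?_⟩
  intro T r₁ r₂ A b u h P κ hκ hP₁ hP₂ hS r θ hθ h1 h2
  set E₀ := Real.exp (α * R ^ 2) with hE₀
  have hE₀pos : 0 < E₀ := Real.exp_pos _
  suffices key : ∀ ε : ℝ, 0 < ε →
      u (polar r θ) ≤ P + (κ / E₀ * Real.exp (-ν * (θ - T)) + ε * Real.exp (ν * θ))
        * radial α R (r ^ 2) by
    have hstep : ∀ ε : ℝ, 0 < ε →
        u (polar r θ) ≤ P + 2 * κ * Real.exp (-ν * (θ - T)) + ε := by
      intro ε hε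
      have hx := Real.exp_pos (ν * θ)
      -- Since `radial ≤ 2 E₀`, this weight makes the growing part contribute at most `ε` at the
      -- fixed angle `θ`.
      have k := key (ε / (2 * E₀ * Real.exp (ν * θ))) (by positivity)
      have k2 := mul_le_mul_of_nonneg_left (radial_le α R (r ^ 2))
        (show 0 ≤ κ / E₀ * Real.exp (-ν * (θ - T))
          + ε / (2 * E₀ * Real.exp (ν * θ)) * Real.exp (ν * θ) by positivity)
      have e : (κ / E₀ * Real.exp (-ν * (θ - T))
          + ε / (2 * E₀ * Real.exp (ν * θ)) * Real.exp (ν * θ)) * (2 * E₀)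
          = 2 * κ * Real.exp (-ν * (θ - T)) + ε := by
        field_simp
      rw [← hE₀, e] at k2
      linarith
    exact le_of_forall_pos_le_add hstep
  intro ε hε
  set f : ℝ → ℝ := fun t => κ / E₀ * Real.exp (-ν * (t - T)) + ε * Real.exp (ν * t) with hf
  set f₁ : ℝ → ℝ := fun t => -ν * (κ / E₀ * Real.exp (-ν * (t - T))) + ν * (ε * Real.exp (ν * t))
    with hf₁
  set f₂ : ℝ → ℝ := fun t => ν ^ 2 * f t with hf₂
  have hexp1 : ∀ t, HasDerivAt (fun t => Real.exp (-ν * (t - T)))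
      (-ν * Real.exp (-ν * (t - T))) t := fun t => by
    have := (((hasDerivAt_id t).sub_const T).const_mul (-ν)).exp
    refine this.congr_deriv ?_
    simp; ring
  have hexp2 : ∀ t, HasDerivAt (fun t => Real.exp (ν * t)) (ν * Real.exp (ν * t)) t := fun t => by
    have := ((hasDerivAt_id t).const_mul ν).exp
    refine this.congr_deriv ?_
    simp; ring
  have hd : ∀ t, HasDerivAt f (f₁ t) t := fun t =>
    (((hexp1 t).const_mul (κ / E₀)).add ((hexp2 t).const_mul ε)).congr_deriv
      (by simp only [hf₁]; ring)
  have hd₁ : ∀ t, HasDerivAt f₁ (f₂ t) t := fun t =>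
    ((((hexp1 t).const_mul (κ / E₀)).const_mul (-ν)).add
      (((hexp2 t).const_mul ε).const_mul ν)).congr_deriv (by simp only [hf₂, hf]; ring)
  have hfs : ContDiff ℝ 2 f := by
    simp only [hf]; fun_prop
  have hterm1 : ∀ t, 0 ≤ κ / E₀ * Real.exp (-ν * (t - T)) := fun t => by positivity
  have hterm2 : ∀ t, 0 < ε * Real.exp (ν * t) := fun t => by positivity
  have hfpos : ∀ t, 0 < f t := fun t => add_pos_of_nonneg_of_pos (hterm1 t) (hterm2 t)
  have hf₁b : ∀ t, |f₁ t| ≤ ν * f t := fun t => by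
    have k1 := mul_nonneg hν.le (hterm1 t)
    have k2 := mul_nonneg hν.le (hterm2 t).le
    simp only [hf₁, hf]
    rw [abs_le]; constructor <;> linarith
  have hf₂b : ∀ t, |f₂ t| ≤ ν * f t := fun t => by
    simp only [hf₂]
    rw [abs_of_nonneg (mul_nonneg (sq_nonneg _) (hfpos t).le)]
    -- Here `ν ≤ 1` is needed, to get `ν² ≤ ν`.
    exact mul_le_mul_of_nonneg_right (by nlinarith) (hfpos t).le
  have hL : ∀ x ∈ dom T r₁ r₂, ∀ θ, x ∈ halfPlane θ → rs ^ 2 ≤ x 0 ^ 2 + x 1 ^ 2 →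
      x 0 ^ 2 + x 1 ^ 2 ≤ R ^ 2 → 0 < ellipticOp A b (barrier α R f θ) x := by
    intro x hx θ hxθ hlow hup
    have hsymm := h.elliptic.symm x hx
    rw [ellipticOp_barrier A b hd hd₁ hxθ hsymm rfl rfl rfl rfl rfl rfl rfl rfl rfl rfl rfl]
    refine hbar _ _ _ _ _ _ _ _ _ _ _ _ _ _ _ _ ?_ ?_ ?_ hlow hup (hfpos _) (hf₁b _) (hf₂b _)
      rfl rfl rfl rfl rfl rfl
    · intro ξ η
      have := h.elliptic.lower x hx !₂[ξ, η]
      rw [quadForm_eq _ hsymm, EuclideanSpace.norm_sq_eq] at this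
      simpa [Fin.sum_univ_two] using this
    · simpa [Matrix.trace, Fin.sum_univ_two] using h.elliptic.trace_le x hx
    · have := h.drift x hx
      have k : ‖b x‖ ^ 2 ≤ M₂ ^ 2 := by gcongr
      rw [EuclideanSpace.norm_sq_eq] at k
      simpa [Fin.sum_univ_two] using k
  have hrad : ∀ r θ, T ≤ θ → r₁ θ ≤ r → r ≤ r₂ θ → E₀ ≤ radial α R (r ^ 2) :=
    fun r θ hθ h1 h2 => le_radial hα.le (h.normSq_le hθ h1 h2)
  set F : ℝ × ℝ → ℝ := fun p => u (polar p.1 p.2) - f p.2 * radial α R (p.1 ^ 2) with hF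
  -- far out, the growing part of the barrier dominates
  obtain ⟨T', hT'θ, hfar⟩ : ∃ T', θ < T' ∧ ∀ r, r₁ T' ≤ r → r ≤ r₂ T' → F (r, T') ≤ P := by
    have hg := h.growth ν hν
    have hPt : Tendsto (fun t : ℝ => Real.exp (-ν * t) * |P|) atTop (𝓝 0) := by
      have : Tendsto (fun t : ℝ => -ν * t) atTop atBot :=
        tendsto_id.const_mul_atTop_of_neg (by linarith)
      simpa using (Real.tendsto_exp_atBot.comp this).mul_const |P|
    have hsum := hg.add hPt
    rw [add_zero] at hsum
    have hev := hsum.eventually_lt_const (show 0 < ε * E₀ by positivity)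
    obtain ⟨T', h3, h4⟩ := (hev.and (eventually_gt_atTop θ)).exists
    refine ⟨T', h4, fun r h5 h6 => ?_⟩
    have hT : T ≤ T' := hθ.trans h4.le
    have k1 := h.abs_le_sSup hT h5 h6
    have k2 := hrad r T' hT h5 h6
    have k3 : |u (polar r T')| + |P| ≤ ε * Real.exp (ν * T') * E₀ := by
      rw [← mul_add] at h3
      have := mul_le_mul_of_nonneg_left h3.le (Real.exp_pos (ν * T')).le
      rw [← mul_assoc, ← Real.exp_add] at this
      simp at this
      linarith
    have k4 : ε * Real.exp (ν * T') * E₀ ≤ f T' * radial α R (r ^ 2) :=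
      mul_le_mul (le_add_of_nonneg_left (hterm1 T')) k2 hE₀pos.le (hfpos T').le
    have := le_abs_self (u (polar r T'))
    have := neg_abs_le P
    simp only [hF]; linarith
  have hcomp := h.isCompact_strip T'
  set D := {p : ℝ × ℝ | T ≤ p.2 ∧ p.2 ≤ T' ∧ r₁ p.2 ≤ p.1 ∧ p.1 ≤ r₂ p.2} with hD
  have hFc : ContinuousOn F D := by
    refine ContinuousOn.sub ?_ (Continuous.continuousOn ?_)
    · exact h.cont.comp continuous_polar.continuousOn
        fun p hp => ⟨p.1, p.2, hp.1, hp.2.2.1, hp.2.2.2, rfl⟩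
    · unfold radial
      have := hfs.continuous
      fun_prop
  have hmemD : ((r, θ) : ℝ × ℝ) ∈ D := ⟨hθ, hT'θ.le, h1, h2⟩
  obtain ⟨⟨ρ, τ⟩, hz, hzmax⟩ := hcomp.exists_isMaxOn ⟨_, hmemD⟩ hFc
  have hle : F (r, θ) ≤ F (ρ, τ) := hzmax hmemD
  suffices F (ρ, τ) ≤ P by
    have : u (polar r θ) - f θ * radial α R (r ^ 2) ≤ P := hle.trans this
    linarith
  obtain ⟨z1, z2, z3, z4⟩ := hz
  simp only at z1 z2 z3 z4
  have hz0 : 0 ≤ f τ * radial α R (ρ ^ 2) :=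
    mul_nonneg (hfpos τ).le (hE₀pos.le.trans (hrad ρ τ z1 z3 z4))
  -- The maximum point lies on a lateral edge, at the far end, at the start or inside, treated in
  -- this order.
  rcases z3.eq_or_lt with e | z3
  · have := hP₁ τ z1
    simp only [hF]; rw [← e] at hz0 ⊢; linarith
  rcases z4.eq_or_lt with e | z4
  · have := hP₂ τ z1
    simp only [hF]; rw [e] at hz0 ⊢; linarith
  rcases z2.eq_or_lt with e | z2
  · subst e; exact hfar ρ z3.le z4.le
  rcases z1.eq_or_lt with e | z1
  · subst e
    have k1 := hS ρ z3.le z4.le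
    have k2 : κ / E₀ * E₀ ≤ f T * radial α R (ρ ^ 2) := by
      refine mul_le_mul ?_ (hrad ρ T le_rfl z3.le z4.le) hE₀pos.le (hfpos T).le
      have := hterm2 T
      simp only [hf, sub_self, mul_zero, Real.exp_zero, mul_one]
      linarith
    rw [div_mul_cancel₀ _ hE₀pos.ne'] at k2
    simp only [hF]; linarith
  · exact (h.not_interior_max hc₀ hfs hL z1 z2 z3 z4
      fun r' θ' a1 a2 a3 a4 => hzmax (show ((r', θ') : ℝ × ℝ) ∈ D from ⟨a1, a2, a3, a4⟩)).elim

/-! ### From one-sided decay to oscillations -/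

lemma osc_le {u : Plane → ℝ} {E : Set Plane} {p m : ℝ} (hE : E.Nonempty)
    (hp : ∀ x ∈ E, u x ≤ p) (hm : ∀ x ∈ E, m ≤ u x) : osc u E ≤ p - m := by
  have h1 : sSup (u '' E) ≤ p := csSup_le (hE.image u) (by rintro _ ⟨x, hx, rfl⟩; exact hp x hx)
  have h2 : m ≤ sInf (u '' E) := le_csInf (hE.image u) (by rintro _ ⟨x, hx, rfl⟩; exact hm x hx)
  unfold osc; linarith

lemma osc_nonneg {u : Plane → ℝ} {E : Set Plane} (hE : E.Nonempty)
    (hb : Bornology.IsBounded (u '' E)) : 0 ≤ osc u E :=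
  sub_nonneg.2 (csInf_le_csSup (hE.image u) hb.bddBelow hb.bddAbove)

lemma crossSection_nonempty {T rs : ℝ} {r₁ r₂ : ℝ → ℝ} (h : IsSpiral T r₁ r₂ rs) {θ : ℝ}
    (hθ : T ≤ θ) : (crossSection r₁ r₂ θ).Nonempty :=
  ⟨_, _, le_rfl, (h.lt θ hθ).le, rfl⟩

lemma le_sSup_image {u : Plane → ℝ} {E : Set Plane} (hb : Bornology.IsBounded (u '' E)) {x : Plane}
    (hx : x ∈ E) : u x ≤ sSup (u '' E) := le_csSup hb.bddAbove ⟨x, hx, rfl⟩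

lemma sInf_image_le {u : Plane → ℝ} {E : Set Plane} (hb : Bornology.IsBounded (u '' E)) {x : Plane}
    (hx : x ∈ E) : sInf (u '' E) ≤ u x := csInf_le hb.bddBelow ⟨x, hx, rfl⟩

/-- The upper bound of `exists_decay_rate`, on the sets of the plane. -/
def HasDecay (T : ℝ) (r₁ r₂ : ℝ → ℝ) (ν : ℝ) (u : Plane → ℝ) : Prop :=
  ∀ T', T ≤ T' → ∀ P κ : ℝ, 0 ≤ κ → (∀ θ, T' ≤ θ → bdryMax r₁ r₂ u θ ≤ P) →
    (∀ x ∈ crossSection r₁ r₂ T', u x ≤ P + κ) →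
    ∀ θ, T' ≤ θ → ∀ x ∈ crossSection r₁ r₂ θ, u x ≤ P + 2 * κ * Real.exp (-ν * (θ - T'))

lemma bdryMax_neg (r₁ r₂ : ℝ → ℝ) (u : Plane → ℝ) (θ : ℝ) :
    bdryMax r₁ r₂ (fun x => -u x) θ = -bdryMin r₁ r₂ u θ := by
  simp [bdryMax, bdryMin, max_neg_neg]

/-- If the boundary values are eventually below `P`, so are the values on the cross-sections, up
to an arbitrarily small error. -/
lemma HasDecay.eventually_le {T ν : ℝ} {r₁ r₂ : ℝ → ℝ} {u : Plane → ℝ}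
    (h : HasDecay T r₁ r₂ ν u) (hν : 0 < ν) {B : ℝ} (hB : ∀ x ∈ domTilde T r₁ r₂, |u x| ≤ B) {P δ : ℝ}
    (hδ : 0 < δ) (hP : ∀ᶠ θ in atTop, bdryMax r₁ r₂ u θ ≤ P) :
    ∀ᶠ θ in atTop, ∀ x ∈ crossSection r₁ r₂ θ, u x ≤ P + δ := by
  obtain ⟨T₁, hT₁⟩ := eventually_atTop.1 hP
  set T' := max T T₁
  -- The global bound `B` controls the excess at the restart angle; truncation at 0 covers the case
  -- `B < P`.
  have hκ : ∀ x ∈ crossSection r₁ r₂ T', u x ≤ P + max 0 (B - P) := fun x hx => by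
    have := le_abs_self (u x)
    have := hB x (IsSolution.crossSection_subset (le_max_left _ _) hx)
    have := le_max_right 0 (B - P)
    linarith
  have hdec := h T' (le_max_left _ _) P _ (le_max_left 0 (B - P))
    (fun θ hθ => hT₁ θ ((le_max_right _ _).trans hθ)) hκ
  have hlim : Tendsto (fun θ : ℝ => 2 * max 0 (B - P) * Real.exp (-ν * (θ - T'))) atTop (𝓝 0) := by
    have h1 : Tendsto (fun θ : ℝ => θ - T') atTop atTop := tendsto_atTop_add_const_right _ _ tendsto_id
    have h2 : Tendsto (fun θ : ℝ => -ν * (θ - T')) atTop atBot :=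
      h1.const_mul_atTop_of_neg (by linarith)
    simpa using (Real.tendsto_exp_atBot.comp h2).const_mul (2 * max 0 (B - P))
  filter_upwards [hlim.eventually_lt_const hδ, eventually_ge_atTop T'] with θ h1 h2 x hx
  linarith [hdec θ h2 x hx]

end Spiral

end

open Spiral

theorem corollary5p2 (rs Rbar c₀ M₁ M₂ : ℝ) (hc₀ : 0 < c₀) (hM₁ : 0 < M₁) (hM₂ : 0 ≤ M₂) :
    -- the constants are chosen before the domain, the coefficients and the solution
    ∃ C ν : ℝ, 0 < C ∧ 0 < ν ∧
      ∀ (θ₀ : ℝ) (r₁ r₂ : ℝ → ℝ), Spiral.IsSpiral θ₀ r₁ r₂ rs →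
      (∀ θ, θ₀ ≤ θ → r₂ θ ≤ Rbar) →
      ∀ (A : Spiral.Plane → Matrix (Fin 2) (Fin 2) ℝ) (b : Spiral.Plane → Spiral.Plane),
      Spiral.IsElliptic (Spiral.dom θ₀ r₁ r₂) A c₀ M₁ →
      (∀ x ∈ Spiral.dom θ₀ r₁ r₂, ‖b x‖ ≤ M₂) →
      ∀ u : Spiral.Plane → ℝ,
      ContDiffOn ℝ 2 u (Spiral.dom θ₀ r₁ r₂) →
      ContinuousOn u (Spiral.domTilde θ₀ r₁ r₂) →
      Bornology.IsBounded (u '' Spiral.lateral θ₀ r₁ r₂) →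
      Spiral.BelowExpGrowth r₁ r₂ u →
      (∀ x ∈ Spiral.dom θ₀ r₁ r₂, Spiral.ellipticOp A b u x = 0) →
      -- `u` is bounded on `Ũ`, so that all the oscillations below are true suprema minus infima
      Bornology.IsBounded (u '' Spiral.domTilde θ₀ r₁ r₂) ∧
      Spiral.osc u (Spiral.domTilde θ₀ r₁ r₂) ≤
        Spiral.osc u (Spiral.crossSection r₁ r₂ θ₀ ∪ Spiral.lateral θ₀ r₁ r₂) ∧
      (∀ θ, θ₀ ≤ θ →
        Spiral.osc u (Spiral.crossSection r₁ r₂ θ) ≤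
          Spiral.osc u (Spiral.lateral θ₀ r₁ r₂) * (1 - C * Real.exp (-ν * (θ - θ₀))) +
          C * Spiral.osc u (Spiral.crossSection r₁ r₂ θ₀ ∪ Spiral.lateral θ₀ r₁ r₂) *
            Real.exp (-ν * (θ - θ₀))) ∧
      limsup (fun θ : ℝ => Spiral.osc u (Spiral.crossSection r₁ r₂ θ)) atTop ≤
        limsup (Spiral.bdryMax r₁ r₂ u) atTop - liminf (Spiral.bdryMin r₁ r₂ u) atTop := by
  -- The constants precede the spiral, which alone supplies `rs > 0`; otherwise the claim is
  -- vacuous.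
  rcases le_or_gt rs 0 with hrs | hrs
  · exact ⟨1, 1, one_pos, one_pos, fun _ _ _ h => absurd h.rs_pos (not_lt.2 hrs)⟩
  obtain ⟨ν, hν, hdecay⟩ := exists_decay_rate rs Rbar c₀ M₁ M₂ hrs hc₀ hM₁ hM₂
  refine ⟨2, ν, two_pos, hν, ?_⟩
  intro θ₀ r₁ r₂ hsp hR A b hA hb u hu huc hbdd hgrowth heq
  have hsol : IsSolution θ₀ r₁ r₂ rs Rbar c₀ M₁ M₂ A b u := ⟨hsp, hR, hA, hb, hu, huc, hgrowth, heq⟩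
  have toDecay : ∀ v, IsSolution θ₀ r₁ r₂ rs Rbar c₀ M₁ M₂ A b v → HasDecay θ₀ r₁ r₂ ν v := by
    rintro v hv T' hT' P κ hκ hP hS θ hθ _ ⟨r, h1, h2, rfl⟩
    exact hdecay T' r₁ r₂ A b v (hv.mono hT') P κ hκ
      (fun t ht => (le_max_left _ _).trans (hP t ht)) (fun t ht => (le_max_right _ _).trans (hP t ht))
      (fun r h1 h2 => hS _ ⟨r, h1, h2, rfl⟩) r θ hθ h1 h2
  have hup := toDecay u hsol
  have hdown := toDecay _ hsol.neg
  set S := crossSection r₁ r₂ θ₀ with hS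
  set L := lateral θ₀ r₁ r₂ with hL
  have hbS : Bornology.IsBounded (u '' S) :=
    ((IsSolution.isCompact_crossSection θ₀).image_of_continuousOn
      (huc.mono (IsSolution.crossSection_subset le_rfl))).isBounded
  have hbSL : Bornology.IsBounded (u '' (S ∪ L)) := by
    rw [image_union]; exact hbS.union hbdd
  have mem₁ : ∀ θ, θ₀ ≤ θ → polar (r₁ θ) θ ∈ L := fun θ hθ => Or.inl ⟨θ, hθ, rfl⟩
  have mem₂ : ∀ θ, θ₀ ≤ θ → polar (r₂ θ) θ ∈ L := fun θ hθ => Or.inr ⟨θ, hθ, rfl⟩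
  have bmax : ∀ {P : ℝ}, (∀ x ∈ L, u x ≤ P) → ∀ θ, θ₀ ≤ θ → bdryMax r₁ r₂ u θ ≤ P :=
    fun h θ hθ => max_le (h _ (mem₁ θ hθ)) (h _ (mem₂ θ hθ))
  have bmin : ∀ {P : ℝ}, (∀ x ∈ L, P ≤ u x) → ∀ θ, θ₀ ≤ θ → P ≤ bdryMin r₁ r₂ u θ :=
    fun h θ hθ => le_min (h _ (mem₁ θ hθ)) (h _ (mem₂ θ hθ))
  have bneg : ∀ {P : ℝ}, (∀ x ∈ L, P ≤ u x) → ∀ θ, θ₀ ≤ θ →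
      bdryMax r₁ r₂ (fun x => -u x) θ ≤ -P := fun h θ hθ => by
    rw [bdryMax_neg]; exact neg_le_neg (bmin h θ hθ)
  have hsup : ∀ x ∈ S ∪ L, u x ≤ sSup (u '' (S ∪ L)) := fun x hx => le_sSup_image hbSL hx
  have hinf : ∀ x ∈ S ∪ L, sInf (u '' (S ∪ L)) ≤ u x := fun x hx => sInf_image_le hbSL hx
  have hLsup : ∀ x ∈ L, u x ≤ sSup (u '' L) := fun x hx => le_sSup_image hbdd hx
  have hLinf : ∀ x ∈ L, sInf (u '' L) ≤ u x := fun x hx => sInf_image_le hbdd hx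
  have tilde_sup : ∀ x ∈ domTilde θ₀ r₁ r₂, u x ≤ sSup (u '' (S ∪ L)) := by
    rintro x ⟨r, θ, hθ, h1, h2, rfl⟩
    have := hup θ₀ le_rfl _ 0 le_rfl (bmax fun x hx => hsup x (Or.inr hx))
      (fun x hx => by rw [add_zero]; exact hsup x (Or.inl hx)) θ hθ _ ⟨r, h1, h2, rfl⟩
    simpa using this
  have tilde_inf : ∀ x ∈ domTilde θ₀ r₁ r₂, sInf (u '' (S ∪ L)) ≤ u x := by
    rintro x ⟨r, θ, hθ, h1, h2, rfl⟩
    have := hdown θ₀ le_rfl _ 0 le_rfl (bneg fun x hx => hinf x (Or.inr hx))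
      (fun x hx => by rw [add_zero]; exact neg_le_neg (hinf x (Or.inl hx))) θ hθ _ ⟨r, h1, h2, rfl⟩
    simpa using this
  have htne : (domTilde θ₀ r₁ r₂).Nonempty :=
    (crossSection_nonempty hsp le_rfl).mono (IsSolution.crossSection_subset le_rfl)
  have hbT : Bornology.IsBounded (u '' domTilde θ₀ r₁ r₂) := by
    refine (Metric.isBounded_Icc (sInf (u '' (S ∪ L))) (sSup (u '' (S ∪ L)))).subset ?_
    rintro _ ⟨x, hx, rfl⟩
    exact ⟨tilde_inf x hx, tilde_sup x hx⟩
  refine ⟨hbT, osc_le htne tilde_sup tilde_inf, ?_, ?_⟩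
  · intro θ hθ
    have hLne : (u '' L).Nonempty := ⟨_, _, mem₁ θ₀ le_rfl, rfl⟩
    have k1 : sSup (u '' L) ≤ sSup (u '' (S ∪ L)) :=
      csSup_le_csSup hbSL.bddAbove hLne (image_mono subset_union_right)
    have k2 : sInf (u '' (S ∪ L)) ≤ sInf (u '' L) :=
      csInf_le_csInf hbSL.bddBelow hLne (image_mono subset_union_right)
    -- The excess `κ` is the gap between the suprema over `S ∪ L` and over `L`. Adding the analogous
    -- gap for the infima gives `osc (S ∪ L) - osc L`, hence the stated formula with `C = 2`.
    have d1 := hup θ₀ le_rfl _ (sSup (u '' (S ∪ L)) - sSup (u '' L)) (by linarith) (bmax hLsup)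
      (fun x hx => by linarith [hsup x (Or.inl hx)]) θ hθ
    have d2 := hdown θ₀ le_rfl _ (sInf (u '' L) - sInf (u '' (S ∪ L))) (by linarith) (bneg hLinf)
      (fun x hx => by linarith [hinf x (Or.inl hx)]) θ hθ
    have := osc_le (crossSection_nonempty hsp hθ) d1 fun x hx => neg_le.1 (d2 x hx)
    refine this.trans (le_of_eq ?_)
    unfold osc
    ring
  · obtain ⟨B, hB⟩ : ∃ B, ∀ x ∈ domTilde θ₀ r₁ r₂, |u x| ≤ B := by
      obtain ⟨B, hB⟩ := hbT.exists_norm_le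
      exact ⟨B, fun x hx => hB _ ⟨x, hx, rfl⟩⟩
    have hbmax : IsBoundedUnder (· ≤ ·) atTop (bdryMax r₁ r₂ u) :=
      isBoundedUnder_of_eventually_le (a := sSup (u '' L)) <| by
        filter_upwards [eventually_ge_atTop θ₀] with θ hθ using bmax hLsup θ hθ
    have hbmin : IsBoundedUnder (· ≥ ·) atTop (bdryMin r₁ r₂ u) :=
      isBoundedUnder_of_eventually_ge (a := sInf (u '' L)) <| by
        filter_upwards [eventually_ge_atTop θ₀] with θ hθ using bmin hLinf θ hθ
    have hcob : IsCoboundedUnder (· ≤ ·) atTop fun θ : ℝ => osc u (crossSection r₁ r₂ θ) := by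
      refine IsBoundedUnder.isCoboundedUnder_le (isBoundedUnder_of_eventually_ge (a := 0) ?_)
      filter_upwards [eventually_ge_atTop θ₀] with θ hθ
      exact osc_nonneg (crossSection_nonempty hsp hθ)
        (hbT.subset (image_mono (IsSolution.crossSection_subset hθ)))
    -- The error `δ` is split in quarters: for each of `u` and `-u`, one for passing to the limit of
    -- the boundary values and one for the decaying term.
    refine le_of_forall_pos_le_add fun δ hδ => limsup_le_of_le hcob ?_
    have e1 := hup.eventually_le hν hB (show 0 < δ / 4 by positivity)
      ((eventually_lt_of_limsup_lt (lt_add_of_pos_right _ (show 0 < δ / 4 by positivity)) hbmax).mono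
        fun θ hθ => hθ.le)
    have e2 := hdown.eventually_le hν (B := B) (fun x hx => by rw [abs_neg]; exact hB x hx)
      (show 0 < δ / 4 by positivity) (P := -(liminf (bdryMin r₁ r₂ u) atTop - δ / 4))
      ((eventually_lt_of_lt_liminf (sub_lt_self _ (show 0 < δ / 4 by positivity)) hbmin).mono
        fun θ hθ => by rw [bdryMax_neg]; exact neg_le_neg hθ.le)
    filter_upwards [e1, e2, eventually_ge_atTop θ₀] with θ h1 h2 hθ
    have := osc_le (crossSection_nonempty hsp hθ) h1
      (m := liminf (bdryMin r₁ r₂ u) atTop - δ / 4 - δ / 4) fun x hx => by linarith [h2 x hx]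
    linarith
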